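/- Let $\mathcal E$ be a finite-dimensional complex Hilbert space and let $V,W$ be rational bi-inner functions, i.e. rational functions that are bounded and analytic in the open unit disc with values in the linear operators on $\mathcal E$, and whose values on the unit circle $\mathbb T$ are unitary almost everywhere. Put $R=VW^*$, where $W^*(z)=\big(W(1/\bar z)\big)^*$. Let $\{A_v,B_v,C_v,D_v\}$ and $\{A_w,B_w,C_w,D_w\}$ be stable unitary realizations of $V$ and $W$ with finite-dimensional complex Hilbert state spaces $\mathcal X_v$ and $\mathcal X_w$. This means that near the origin $V(z)=D_v+zC_v(I-zA_v)^{-1}B_v$, that all eigenvalues of $A_v$ lie in the open unit disc, and that $\begin{bmatrix}A_v&B_v\\ C_v&D_v\end{bmatrix}$ is unitary on $\mathcal X_v\oplus\mathcal E$; similarly for $W$. Then the Stein equation $$\Omega=A_v\Omega A_w^*+B_vB_w^*$$ has a unique solution $\Omega:\mathcal X_w\to\mathcal X_v$. Set $$C_\circ=D_vB_w^*+C_v\Omega A_w^*:\mathcal X_w\to\mathcal E .$$ The Stein equation $$Q=A_wQA_w^*+C_\circ^*C_\circ$$ has a unique solution $Q:\mathcal X_w\to\mathcal X_w$. For a function $F$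 on $\mathbb T$ with Fourier coefficients $F_n$, let $T_F=(F_{i-j})_{i,j\ge0}$ be the Toeplitz operator on $\ell^2_+(\mathcal E)$, and write $\mathfrak n(T)=\dim\ker T$. Then the following hold. 1. $Q$ is a positive contraction, i.e. $Q\ge 0$ and $\|Q\|\le1$. 2. $T_{z^kR}$ is a bounded operator with finite-dimensional kernel for every integer $k\ge0$. The multiplicity of $1$ as an eigenvalue of $Q$ (i.e. as a root of its characteristic polynomial) equals $\mathfrak n(T_R)$, and $\mathfrak n(T_R)=\mathfrak n(I-Q)$. Moreover, for every integer $k\ge0$, $$\mathfrak n(T_{z^kR})=\mathfrak n\big(I-A_w^kQA_w^{*k}\big).$$ 3. For $k=1,2,\dots$ put $$\mu_k=\mathfrak n\big(I-A_w^{k-1}QA_w^{*(k-1)}\big)-\mathfrak n\big(I-A_w^{k}QA_w^{*k}\big).$$ Let $R(z)=W_-(z)\,\mathrm{diag}(z^{\nu_1},\dots,z^{\nu_m})\,W_+(z)$ for $z\in\mathbb T$ be any Wiener–Hopf factorization. Here $m=\dim\mathcal E$, the diagonal operator is taken with respect to some basis of $\mathcal E$, $\nu_i\in\mathbb Z$,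 $W_+$ and its inverse are analytic in the closed unit disc, and $W_-$ and its inverse are analytic outside the open unit disc, including infinity. Let $-\kappa_1,\dots,-\kappa_p$ with $\kappa_1\ge\dots\ge\kappa_p$ be the negative ones among $\nu_1,\dots,\nu_m$, counted with multiplicity (the negative Wiener–Hopf indices of $R$). Then $p=\mu_1$ and $$\kappa_j=\#\{k\ge1:\mu_k\ge j\},\qquad j=1,\dots,p .$$ -/

import Mathlib

open scoped InnerProductSpace

noncomputable section

namespace WienerHopf

section Functions

variable {E : Type*} [NormedAddCommGroup E] [InnerProductSpace ℂ E] [CompleteSpace E]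

/-- The operator-valued function `F` coincides on `S` with a quotient `P / q` of an operator-valued
polynomial `P` by a scalar polynomial `q` without zeros in `S`: it is rational, without poles
in `S`. (A rational function that is bounded on the open unit disc has no poles in the closed unit
disc, and its values on the unit circle are those of the quotient.) -/
def IsRationalOn (F : ℂ → E →L[ℂ] E) (S : Set ℂ) : Prop :=
  ∃ (q : Polynomial ℂ) (n : ℕ) (P : ℕ → E →L[ℂ] E), ∀ z ∈ S,
    q.eval z ≠ 0 ∧ F z = (q.eval z)⁻¹ • ∑ i ∈ Finset.range n, z ^ i • P i

/-- Bi-inner functions: bounded analytic functions in the open unit disc whose radial boundary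
values are unitary operators almost everywhere on the unit circle. -/
structure IsBiInner (Θ : ℂ → E →L[ℂ] E) : Prop where
  differentiableOn : DifferentiableOn ℂ Θ (Metric.ball 0 1)
  bounded : ∃ M : ℝ, ∀ z ∈ Metric.ball (0 : ℂ) 1, ‖Θ z‖ ≤ M
  unitary_boundary : ∀ᵐ t : UnitAddCircle, ∃ U ∈ unitary (E →L[ℂ] E),
    Filter.Tendsto (fun r : ℝ => Θ ((r : ℂ) * (AddCircle.toCircle t : ℂ)))
      (nhdsWithin 1 (Set.Iio 1)) (nhds U)

/-- The function `W^*(z) = (W(1 / conj z))^*`. -/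
def starFun (W : ℂ → E →L[ℂ] E) (z : ℂ) : E →L[ℂ] E :=
  ContinuousLinearMap.adjoint (W (1 / (starRingEnd ℂ) z))

end Functions

section Realizations

variable {X E : Type*} [NormedAddCommGroup X] [InnerProductSpace ℂ X] [CompleteSpace X]
  [NormedAddCommGroup E] [InnerProductSpace ℂ E] [CompleteSpace E]

/-- `Θ(z) = D + z C (I - z A)⁻¹ B` in some neighborhood of the origin. -/
def IsRealization (A : X →L[ℂ] X) (B : E →L[ℂ] X) (C : X →L[ℂ] E) (D : E →L[ℂ] E)
    (Θ : ℂ → E →L[ℂ] E) : Prop :=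
  ∀ᶠ z in nhds (0 : ℂ), Θ z = D + z • (C ∘L Ring.inverse (1 - z • A) ∘L B)

/-- All eigenvalues of `A` lie in the open unit disc. -/
def IsStable (A : X →L[ℂ] X) : Prop :=
  ∀ c : ℂ, Module.End.HasEigenvalue (A : X →ₗ[ℂ] X) c → ‖c‖ < 1

/-- The systems operator `[A B; C D]` on the Hilbert space direct sum `X ⊕ E`. -/
def systemsOperator (A : X →L[ℂ] X) (B : E →L[ℂ] X) (C : X →L[ℂ] E) (D : E →L[ℂ] E) :
    WithLp 2 (X × E) →L[ℂ] WithLp 2 (X × E) :=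
  ((WithLp.prodContinuousLinearEquiv 2 ℂ X E).symm : X × E →L[ℂ] WithLp 2 (X × E)) ∘L
    ((A.coprod B).prod (C.coprod D)) ∘L
    (WithLp.prodContinuousLinearEquiv 2 ℂ X E : WithLp 2 (X × E) →L[ℂ] X × E)

/-- A stable unitary realization `{A, B, C, D}` of `Θ`. -/
structure IsStableUnitaryRealization (A : X →L[ℂ] X) (B : E →L[ℂ] X) (C : X →L[ℂ] E)
    (D : E →L[ℂ] E) (Θ : ℂ → E →L[ℂ] E) : Prop where
  realization : IsRealization A B C D Θ
  stable : IsStable A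
  isUnitary : systemsOperator A B C D ∈ unitary (WithLp 2 (X × E) →L[ℂ] WithLp 2 (X × E))

/-- The dimension of the kernel of `I - A^k Q (A^*)^k`. -/
def defectNullity (A Q : X →L[ℂ] X) (k : ℕ) : ℕ :=
  Module.finrank ℂ (LinearMap.ker
    ((1 - A ^ k * Q * (ContinuousLinearMap.adjoint A) ^ k : X →L[ℂ] X) : X →ₗ[ℂ] X))

/-- The integers
`μ_k = dim ker (I - A^(k-1) Q (A^*)^(k-1)) - dim ker (I - A^k Q (A^*)^k)`, for `k ≥ 1`. -/
def mu (A Q : X →L[ℂ] X) (k : ℕ) : ℤ :=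
  (defectNullity A Q (k - 1) : ℤ) - (defectNullity A Q k : ℤ)

end Realizations

section Toeplitz

variable {E : Type*} [NormedAddCommGroup E] [InnerProductSpace ℂ E] [CompleteSpace E]

/-- The `n`-th Fourier coefficient of the restriction of `F` to the unit circle. -/
def circleCoeff (F : ℂ → E →L[ℂ] E) (n : ℤ) : E →L[ℂ] E :=
  fourierCoeff (fun t : UnitAddCircle => F (AddCircle.toCircle t : ℂ)) n

/-- `T` is the Toeplitz operator `T_F` on `ℓ²₊(E)`: the bounded operator
given by the block matrix `(F_{i-j})_{i,j ≥ 0}` of Fourier coefficients of `F`. -/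
def IsToeplitzOperator (F : ℂ → E →L[ℂ] E)
    (T : lp (fun _ : ℕ => E) 2 →L[ℂ] lp (fun _ : ℕ => E) 2) : Prop :=
  ∀ (f : lp (fun _ : ℕ => E) 2) (i : ℕ),
    HasSum (fun j : ℕ => circleCoeff F ((i : ℤ) - (j : ℤ)) (f j)) (T f i)

/-- There is at most one Toeplitz operator with a given symbol. -/
theorem IsToeplitzOperator.unique {F : ℂ → E →L[ℂ] E}
    {T T' : lp (fun _ : ℕ => E) 2 →L[ℂ] lp (fun _ : ℕ => E) 2}
    (h : IsToeplitzOperator F T) (h' : IsToeplitzOperator F T') : T = T' := by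
  ext f i
  exact (h f i).unique (h' f i)

/-- The Toeplitz operator `T_F` exists as a bounded operator on `ℓ²₊(E)` and its kernel has finite
dimension `n`. -/
def HasToeplitzNullity (F : ℂ → E →L[ℂ] E) (n : ℕ) : Prop :=
  ∃ T : lp (fun _ : ℕ => E) 2 →L[ℂ] lp (fun _ : ℕ => E) 2,
    IsToeplitzOperator F T ∧
    FiniteDimensional ℂ (LinearMap.ker (T : lp (fun _ : ℕ => E) 2 →ₗ[ℂ] lp (fun _ : ℕ => E) 2)) ∧
    Module.finrank ℂ
      (LinearMap.ker (T : lp (fun _ : ℕ => E) 2 →ₗ[ℂ] lp (fun _ : ℕ => E) 2)) = n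

end Toeplitz

section Factorization

variable {E : Type*} [NormedAddCommGroup E] [InnerProductSpace ℂ E] [FiniteDimensional ℂ E]

/-- `G` takes invertible values on the closed unit disc, and `G` and `G⁻¹` are analytic
there (that is, in a neighborhood of each of its points). -/
structure IsAnalyticUnitOnDisc (G : ℂ → E →L[ℂ] E) : Prop where
  isUnit : ∀ z ∈ Metric.closedBall (0 : ℂ) 1, IsUnit (G z)
  analytic : AnalyticOnNhd ℂ G (Metric.closedBall 0 1)
  analytic_inverse : AnalyticOnNhd ℂ (fun z => Ring.inverse (G z)) (Metric.closedBall 0 1)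

/-- The operator `diag(z ^ ν_j)` with respect to the basis `b`. -/
def diagPow {m : ℕ} (b : Module.Basis (Fin m) ℂ E) (ν : Fin m → ℤ) (z : ℂ) : E →L[ℂ] E :=
  LinearMap.toContinuousLinearMap (Matrix.toLin b b (Matrix.diagonal fun j => z ^ ν j))

/-- `ν` lists (in any order) the diagonal exponents of a right Wiener-Hopf factorization
`F(z) = W₋(z) diag(z ^ ν_j) W₊(z)` with respect to the unit circle. Here `W₊^{±1}` are analytic in
the closed unit disc, and `W₋(z) = M(z⁻¹)` where `M^{±1}` are analytic in the closed unit
disc: this says that `W₋^{±1}` are analytic outside the open unit disc, including infinity, the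
value at infinity being `M 0`. -/
def IsWienerHopfIndices (F : ℂ → E →L[ℂ] E) (ν : Fin (Module.finrank ℂ E) → ℤ) : Prop :=
  ∃ (b : Module.Basis (Fin (Module.finrank ℂ E)) ℂ E) (M Wp : ℂ → E →L[ℂ] E),
    IsAnalyticUnitOnDisc M ∧ IsAnalyticUnitOnDisc Wp ∧
    ∀ z ∈ Metric.sphere (0 : ℂ) 1, F z = M z⁻¹ ∘L diagPow b ν z ∘L Wp z

/-- `-κ_1, …, -κ_p`, with `κ_1 ≥ ⋯ ≥ κ_p`, are the negative Wiener-Hopf indices of `F`, repeated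
according to multiplicity; `κ_(j+1)` is `κ j`, as `Fin p` starts at zero. -/
def IsNegativeWienerHopfIndices (F : ℂ → E →L[ℂ] E) (p : ℕ) (κ : Fin p → ℤ) : Prop :=
  Antitone κ ∧ ∃ ν : Fin (Module.finrank ℂ E) → ℤ, IsWienerHopfIndices F ν ∧
    (Finset.univ.val.map fun j => -κ j) = (Finset.univ.val.map ν).filter (· < 0)

end Factorization

end WienerHopf

end

/-! On the circle, `V`, `W` and the Wiener–Hopf factors have absolutely summable Fourier
coefficients, so they act by convolution on bounded two-sided sequences. Pointwise identities such
as `V^* V = 1` become identities between convolutions, and one-sided coefficients express causality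
or anticausality.

Let `f` lie in the kernel of the Toeplitz operator of `z^k R`, and put `h = W^* f`. Then `V h = R f`
vanishes at all times `≥ -k`, so the anticausal operator `V^*` gives `h = 0` at times `≥ 0`. Hence
`f = W h` is, at times `n ≥ 0`, the free response `C_w A_w^n x` from the state `x` of `W` at time 0.
The input `B_w^* (A_w^*)^m x` at times `-1-m` has the same response, because the system of `W` is
coisometric; so `f` is determined by `x`. Feeding this input to `V` gives the output `C_v A_v^n Ω x`
at times `n ≥ 0` and `C₀ (A_w^*)^j x` at times `-1-j`. By observability, the kernel is therefore
parametrized by the `x` with `Ω x = 0` and `C₀ (A_w^*)^j x = 0` for `j < k`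
(`hasToeplitzNullity_defect`).

Unitarity of both systems shows that `1 - Ω^* Ω` solves the second Stein equation, so it equals `Q`
(`stein_one_sub_adjoint_comp`, `stein_unique`). Iteration gives `1 - A_w^k Q (A_w^*)^k = Ω^* Ω +
∑_{j<k} A_w^j C₀^* C₀ (A_w^*)^j`, whose kernel is this same space (`mem_ker_defect_iff`).

From a Wiener–Hopf factorization, the same nullity is `∑_j max(-ν_j - k, 0)`. Its successive
differences count the `κ_j ≥ k`, so `μ` and `κ` are conjugate partitions. -/

noncomputable section

set_option linter.unusedSectionVars false

namespace WienerHopf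

/-! ### Convolution by absolutely summable operator sequences -/

section Convolution

variable {E : Type*} [NormedAddCommGroup E] [InnerProductSpace ℂ E]

/-- The convolution of an operator sequence with a vector sequence. -/
def conv (a : ℤ → E →L[ℂ] E) (f : ℤ → E) (n : ℤ) : E := ∑' j, a j (f (n - j))

/-- Bounded sequences of vectors. -/
def IsBdd (f : ℤ → E) : Prop := ∃ M : ℝ, ∀ n, ‖f n‖ ≤ M

/-- The convolution product of two operator sequences. -/
def convMul (a b : ℤ → E →L[ℂ] E) (n : ℤ) : E →L[ℂ] E := ∑' j, a j * b (n - j)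

theorem hasSum_of_eq {ι G : Type*} [AddCommMonoid G] [TopologicalSpace G] {f g : ι → G} {x : G}
    (h : HasSum f x) (hfg : ∀ i, g i = f i) : HasSum g x :=
  funext hfg ▸ h

theorem isBdd_of_summable {f : ℤ → E} (hf : Summable fun n => ‖f n‖) : IsBdd f :=
  ⟨∑' n, ‖f n‖, fun n => hf.le_tsum n fun _ _ => norm_nonneg _⟩

/-- The product family on `ℤ × ℤ`, reindexed so that its rows are the terms of a convolution. It
yields both the convergence of each row and the summability of the row sums. -/
theorem summable_shear {α β : ℤ → ℝ} (hα : Summable α) (hβ : Summable β) (hα0 : 0 ≤ α)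
    (hβ0 : 0 ≤ β) : Summable fun p : ℤ × ℤ => α p.2 * β (p.1 - p.2) := by
  let e : ℤ × ℤ ≃ ℤ × ℤ :=
    { toFun := fun p => (p.2, p.1 - p.2)
      invFun := fun p => (p.1 + p.2, p.1)
      left_inv := fun p => by simp
      right_inv := fun p => by simp }
  exact e.summable_iff.mpr (hα.mul_of_nonneg hβ hα0 hβ0)

theorem summable_norm_convMul {a b : ℤ → E →L[ℂ] E} (ha : Summable fun n => ‖a n‖)
    (hb : Summable fun n => ‖b n‖) : Summable fun n => ‖convMul a b n‖ := by
  have h := summable_shear ha hb (fun _ => norm_nonneg _) fun _ => norm_nonneg _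
  have hfib := h.prod_factor
  refine Summable.of_nonneg_of_le (fun _ => norm_nonneg _) (fun n => ?_) h.prod
  have h1 : Summable fun j => ‖a j * b (n - j)‖ :=
    Summable.of_nonneg_of_le (fun _ => norm_nonneg _) (fun j => norm_mul_le _ _) (hfib n)
  exact (norm_tsum_le_tsum_norm h1).trans
    (h1.tsum_le_tsum (fun j => norm_mul_le _ _) (hfib n))

variable [CompleteSpace E]

theorem hasSum_convMul {a b : ℤ → E →L[ℂ] E} (ha : Summable fun n => ‖a n‖)
    (hb : Summable fun n => ‖b n‖) (n : ℤ) :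
    HasSum (fun j => a j * b (n - j)) (convMul a b n) := by
  have h := (summable_shear ha hb (fun _ => norm_nonneg _) fun _ => norm_nonneg _).prod_factor n
  exact (Summable.of_norm_bounded h fun j => norm_mul_le _ _).hasSum

theorem summable_norm_conv_term {a : ℤ → E →L[ℂ] E} (ha : Summable fun n => ‖a n‖) {f : ℤ → E}
    (hf : IsBdd f) (n : ℤ) : Summable fun j => ‖a j (f (n - j))‖ := by
  obtain ⟨M, hM⟩ := hf
  exact Summable.of_nonneg_of_le (fun _ => norm_nonneg _)
    (fun j => ((a j).le_opNorm _).trans (mul_le_mul_of_nonneg_left (hM _) (norm_nonneg _)))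
    (ha.mul_right M)

theorem hasSum_conv {a : ℤ → E →L[ℂ] E} (ha : Summable fun n => ‖a n‖) {f : ℤ → E}
    (hf : IsBdd f) (n : ℤ) : HasSum (fun j => a j (f (n - j))) (conv a f n) :=
  (summable_norm_conv_term ha hf n).of_norm.hasSum

theorem IsBdd.conv {a : ℤ → E →L[ℂ] E} (ha : Summable fun n => ‖a n‖) {f : ℤ → E}
    (hf : IsBdd f) : IsBdd (conv a f) := by
  obtain ⟨M, hM⟩ := hf
  refine ⟨∑' j, ‖a j‖ * M, fun n => ?_⟩
  have h1 := summable_norm_conv_term ha ⟨M, hM⟩ n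
  exact (norm_tsum_le_tsum_norm h1).trans (h1.tsum_le_tsum
    (fun j => ((a j).le_opNorm _).trans (mul_le_mul_of_nonneg_left (hM _) (norm_nonneg _)))
    (ha.mul_right M))

theorem conv_add {a : ℤ → E →L[ℂ] E} (ha : Summable fun n => ‖a n‖) {f g : ℤ → E}
    (hf : IsBdd f) (hg : IsBdd g) : conv a (f + g) = conv a f + conv a g := by
  funext n
  have := (hasSum_conv ha hf n).add (hasSum_conv ha hg n)
  simp only [← map_add] at this
  exact this.tsum_eq

theorem conv_smul (a : ℤ → E →L[ℂ] E) (c : ℂ) (f : ℤ → E) : conv a (c • f) = c • conv a f := by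
  funext n
  simp only [conv, Pi.smul_apply, map_smul]
  exact tsum_const_smul'' c

theorem summable_norm_conv {a : ℤ → E →L[ℂ] E} (ha : Summable fun n => ‖a n‖) {f : ℤ → E}
    (hf : Summable fun n => ‖f n‖) : Summable fun n => ‖conv a f n‖ := by
  have h := summable_shear ha hf (fun _ => norm_nonneg _) fun _ => norm_nonneg _
  have hfib := h.prod_factor
  refine Summable.of_nonneg_of_le (fun _ => norm_nonneg _) (fun n => ?_) h.prod
  have h1 := summable_norm_conv_term ha (isBdd_of_summable hf) n
  exact (norm_tsum_le_tsum_norm h1).trans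
    (h1.tsum_le_tsum (fun j => (a j).le_opNorm _) (hfib n))

/-- Fubini: both sides sum one double family, dominated by `‖a‖ ‖b‖` times a bound for `f`.
Boundedness of `f` suffices, which covers square summable sequences. -/
theorem conv_convMul {a b : ℤ → E →L[ℂ] E} (ha : Summable fun n => ‖a n‖)
    (hb : Summable fun n => ‖b n‖) {f : ℤ → E} (hf : IsBdd f) :
    conv (convMul a b) f = conv a (conv b f) := by
  funext n
  obtain ⟨M, hM⟩ := hf
  have hsh := (summable_shear ha hb (fun _ => norm_nonneg _) fun _ => norm_nonneg _).mul_right M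
  have hF : Summable fun p : ℤ × ℤ => a p.2 (b (p.1 - p.2) (f (n - p.1))) := by
    refine Summable.of_norm_bounded hsh fun p => ?_
    refine ((a p.2).le_opNorm _).trans ?_
    rw [mul_assoc]
    exact mul_le_mul_of_nonneg_left (((b _).le_opNorm _).trans
      (mul_le_mul_of_nonneg_left (hM _) (norm_nonneg _))) (norm_nonneg _)
  have hl : conv (convMul a b) f n = ∑' p : ℤ × ℤ, a p.2 (b (p.1 - p.2) (f (n - p.1))) := by
    rw [hF.tsum_prod]
    refine tsum_congr fun m => ?_
    exact (((hasSum_convMul ha hb m).mapL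
      (ContinuousLinearMap.apply ℂ E (f (n - m)))).tsum_eq).symm
  let e : ℤ × ℤ ≃ ℤ × ℤ :=
    { toFun := fun p => (p.1 + p.2, p.1)
      invFun := fun p => (p.2, p.1 - p.2)
      left_inv := fun p => by simp
      right_inv := fun p => by simp }
  have hG := e.summable_iff.mpr hF
  rw [hl, ← e.tsum_eq]
  refine (Summable.tsum_prod hG).trans ?_
  refine tsum_congr fun j => ?_
  have := ((hasSum_conv hb ⟨M, hM⟩ (n - j)).mapL (a j)).tsum_eq
  rw [← this]
  refine tsum_congr fun k => ?_
  simp [e, sub_sub]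

theorem conv_single_one (f : ℤ → E) : conv (Pi.single 0 1) f = f := by
  funext n
  rw [conv, tsum_eq_single 0]
  · simp
  · intro j hj
    simp [Pi.single_eq_of_ne hj]

end Convolution

/-! ### Functions on the circle with absolutely summable Fourier series -/

section Symbols

variable {E : Type*} [NormedAddCommGroup E] [InnerProductSpace ℂ E]

/-- `F(z) = ∑ z ^ n a_n` on the unit circle, with absolutely summable coefficients. -/
structure IsSymbol (a : ℤ → E →L[ℂ] E) (F : ℂ → E →L[ℂ] E) : Prop where
  summable : Summable fun n => ‖a n‖
  hasSum : ∀ z ∈ Metric.sphere (0 : ℂ) 1, HasSum (fun n => z ^ n • a n) (F z)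

theorem IsSymbol.congr {a : ℤ → E →L[ℂ] E} {F G : ℂ → E →L[ℂ] E} (h : IsSymbol a F)
    (hFG : ∀ z ∈ Metric.sphere (0 : ℂ) 1, F z = G z) : IsSymbol a G :=
  ⟨h.summable, fun z hz => hFG z hz ▸ h.hasSum z hz⟩

theorem norm_zpow_sphere {z : ℂ} (hz : z ∈ Metric.sphere (0 : ℂ) 1) (n : ℤ) : ‖z ^ n‖ = 1 := by
  rw [norm_zpow, mem_sphere_zero_iff_norm.mp hz, one_zpow]

theorem ne_zero_of_mem_sphere_one {z : ℂ} (hz : z ∈ Metric.sphere (0 : ℂ) 1) : z ≠ 0 :=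
  ne_zero_of_mem_unit_sphere ⟨z, hz⟩

theorem inv_mem_sphere {z : ℂ} (hz : z ∈ Metric.sphere (0 : ℂ) 1) :
    z⁻¹ ∈ Metric.sphere (0 : ℂ) 1 := by
  simpa using hz

theorem isSymbol_single (m : ℤ) (A : E →L[ℂ] E) :
    IsSymbol (Pi.single m A) fun z => z ^ m • A where
  summable := summable_of_ne_finset_zero (s := {m}) fun n hn => by
    rw [Pi.single_eq_of_ne (by simpa using hn), norm_zero]
  hasSum z _ := by
    have := hasSum_single (f := fun n : ℤ => z ^ n • (Pi.single m A : ℤ → E →L[ℂ] E) n) m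
      fun n hn => by rw [Pi.single_eq_of_ne hn, smul_zero]
    simpa using this

theorem isSymbol_one : IsSymbol (Pi.single 0 1 : ℤ → E →L[ℂ] E) fun _ => 1 :=
  (isSymbol_single 0 1).congr fun z _ => by simp

theorem IsSymbol.reflect {a : ℤ → E →L[ℂ] E} {F : ℂ → E →L[ℂ] E} (h : IsSymbol a F) :
    IsSymbol (fun n => a (-n)) fun z => F z⁻¹ where
  summable := (Equiv.neg ℤ).summable_iff.mpr h.summable
  hasSum z hz := by
    have := (Equiv.neg ℤ).hasSum_iff.mpr (h.hasSum z⁻¹ (inv_mem_sphere hz))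
    simpa [Function.comp_def] using this

theorem IsSymbol.shift {a : ℤ → E →L[ℂ] E} {F : ℂ → E →L[ℂ] E} (h : IsSymbol a F) (k : ℤ) :
    IsSymbol (fun n => a (n - k)) fun z => z ^ k • F z where
  summable := h.summable.comp_injective (sub_left_injective (b := k))
  hasSum z hz := by
    have hz0 := ne_zero_of_mem_sphere_one hz
    refine hasSum_of_eq ((Equiv.subRight k).hasSum_iff.mpr
      ((h.hasSum z hz).const_smul (z ^ k))) fun n => ?_
    rw [Function.comp_apply, Equiv.subRight_apply, smul_smul, ← zpow_add₀ hz0, add_sub_cancel]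

theorem IsSymbol.sum {ι : Type*} (s : Finset ι) {a : ι → ℤ → E →L[ℂ] E} {F : ι → ℂ → E →L[ℂ] E}
    (h : ∀ i ∈ s, IsSymbol (a i) (F i)) :
    IsSymbol (fun n => ∑ i ∈ s, a i n) fun z => ∑ i ∈ s, F i z where
  summable := Summable.of_nonneg_of_le (fun _ => norm_nonneg _) (fun n => norm_sum_le _ _)
    (summable_sum fun i hi => (h i hi).summable)
  hasSum z hz := by
    simp only [Finset.smul_sum]
    exact hasSum_sum fun i hi => (h i hi).hasSum z hz

variable [CompleteSpace E]

/-- On the circle the conjugate of `z` is `z⁻¹`, which reverses the coefficients; a causal symbol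
thus gets an anticausal adjoint. -/
theorem IsSymbol.adjoint {a : ℤ → E →L[ℂ] E} {F : ℂ → E →L[ℂ] E} (h : IsSymbol a F) :
    IsSymbol (fun n => (a (-n)).adjoint) fun z => (F z).adjoint where
  summable := by
    simpa [Function.comp_def] using (Equiv.neg ℤ).summable_iff.mpr h.summable
  hasSum z hz := by
    have h1 := (Equiv.neg ℤ).hasSum_iff.mpr (h.hasSum z hz)
    have h2 := h1.star
    simp only [← ContinuousLinearMap.star_eq_adjoint]
    refine hasSum_of_eq h2 fun n => ?_
    have hc : star z = z⁻¹ := by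
      rw [Complex.inv_def, Complex.normSq_eq_norm_sq, mem_sphere_zero_iff_norm.mp hz]
      simp
    simp [star_smul, hc]

theorem hasSum_mul_of_summable_norm {S : Type*} [NormedRing S] [CompleteSpace S] {f g : ℤ → S}
    {x y : S} (hf : HasSum f x) (hg : HasSum g y) (hf' : Summable fun n => ‖f n‖)
    (hg' : Summable fun n => ‖g n‖) : HasSum (fun p : ℤ × ℤ => f p.1 * g p.2) (x * y) :=
  hf.mul hg (summable_mul_of_summable_norm hf' hg')

theorem IsSymbol.mul {a b : ℤ → E →L[ℂ] E} {F G : ℂ → E →L[ℂ] E} (ha : IsSymbol a F)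
    (hb : IsSymbol b G) : IsSymbol (convMul a b) fun z => F z * G z where
  summable := summable_norm_convMul ha.summable hb.summable
  hasSum z hz := by
    have hz0 := ne_zero_of_mem_sphere_one hz
    have hna : Summable fun n => ‖z ^ n • a n‖ := by
      simpa [norm_smul, norm_zpow_sphere hz, -norm_zpow] using ha.summable
    have hnb : Summable fun n => ‖z ^ n • b n‖ := by
      simpa [norm_smul, norm_zpow_sphere hz, -norm_zpow] using hb.summable
    have hab := hasSum_mul_of_summable_norm (ha.hasSum z hz) (hb.hasSum z hz) hna hnb
    let e : ℤ × ℤ ≃ ℤ × ℤ :=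
      { toFun := fun p => (p.2, p.1 - p.2)
        invFun := fun p => (p.1 + p.2, p.1)
        left_inv := fun p => by simp
        right_inv := fun p => by simp }
    have hab' : HasSum (fun p : ℤ × ℤ => z ^ p.1 • (a p.2 * b (p.1 - p.2))) (F z * G z) := by
      refine hasSum_of_eq (e.hasSum_iff.mpr hab) fun p => ?_
      have h : z ^ p.1 = z ^ p.2 * z ^ (p.1 - p.2) := by
        rw [← zpow_add₀ hz0, add_sub_cancel]
      rw [h]
      exact (smul_mul_smul_comm (z ^ p.2) (a p.2) (z ^ (p.1 - p.2)) (b (p.1 - p.2))).symm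
    exact hab'.prod_fiberwise fun n =>
      (hasSum_convMul ha.summable hb.summable n).const_smul (z ^ n)

/-- Absolute summability permits termwise integration, and the characters are orthonormal.
Consequently the coefficients of a symbol are unique, so that pointwise identities transfer to
convolutions. -/
theorem IsSymbol.circleCoeff {a : ℤ → E →L[ℂ] E} {F : ℂ → E →L[ℂ] E} (h : IsSymbol a F) (n : ℤ) :
    circleCoeff F n = a n := by
  have hsph : ∀ t : UnitAddCircle, ((AddCircle.toCircle t : Circle) : ℂ) ∈
      Metric.sphere (0 : ℂ) 1 := fun t => (AddCircle.toCircle t).2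
  have key : ∀ (m : ℤ) (t : UnitAddCircle),
      ((AddCircle.toCircle t : Circle) : ℂ) ^ m = fourier m t := fun m t => by
    rw [fourier_apply, AddCircle.toCircle_zsmul, Circle.coe_zpow]
  have hF : (fun t : UnitAddCircle => F (AddCircle.toCircle t : ℂ)) =
      fun t => ∑' m, fourier m t • a m := by
    funext t
    rw [← (h.hasSum _ (hsph t)).tsum_eq]
    simp only [key]
  have hnorm : ∀ (m : ℤ) (t : UnitAddCircle), ‖(fourier m t : ℂ)‖ = 1 := fun m t => by
    rw [← key, norm_zpow_sphere (hsph t)]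
  unfold WienerHopf.circleCoeff fourierCoeff
  rw [hF]
  have hint : ∀ m : ℤ, MeasureTheory.Integrable
      (fun t : UnitAddCircle => fourier (-n) t • fourier m t • a m) AddCircle.haarAddCircle := by
    intro m
    refine Continuous.integrable_of_hasCompactSupport ?_ (HasCompactSupport.of_compactSpace _)
    fun_prop
  have h1 : HasSum (fun m : ℤ =>
      ∫ t : UnitAddCircle, fourier (-n) t • fourier m t • a m ∂AddCircle.haarAddCircle)
      (∫ t : UnitAddCircle, ∑' m, fourier (-n) t • fourier m t • a m
        ∂AddCircle.haarAddCircle) := by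
    refine MeasureTheory.hasSum_integral_of_summable_integral_norm hint ?_
    simpa [norm_smul, hnorm, -fourier_apply] using h.summable
  have h2 : ∀ t : UnitAddCircle, ∑' m, fourier (-n) t • fourier m t • a m =
      fourier (-n) t • ∑' m, fourier m t • a m := fun t => tsum_const_smul'' _
  simp only [h2] at h1
  have h3 : ∀ m : ℤ, ∫ t : UnitAddCircle, fourier (-n) t • fourier m t • a m
      ∂AddCircle.haarAddCircle = if m = n then a m else 0 := by
    intro m
    have := fourierCoeff_fourier (T := (1 : ℝ)) m
    have h4 := congrFun this n
    unfold fourierCoeff at h4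
    simp only [← smul_assoc]
    rw [integral_smul_const, h4]
    by_cases hmn : m = n
    · subst hmn; simp
    · rw [Pi.single_eq_of_ne (Ne.symm hmn)]; simp [hmn]
  simp only [h3] at h1
  have h5 := hasSum_ite_eq n (a n)
  refine h1.unique (hasSum_of_eq h5 fun m => ?_)
  by_cases hmn : m = n <;> simp [hmn]

theorem IsSymbol.unique {a b : ℤ → E →L[ℂ] E} {F : ℂ → E →L[ℂ] E} (ha : IsSymbol a F)
    (hb : IsSymbol b F) : a = b :=
  funext fun n => (ha.circleCoeff n).symm.trans (hb.circleCoeff n)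

theorem IsSymbol.conv_conv {a b c : ℤ → E →L[ℂ] E} {F G H : ℂ → E →L[ℂ] E} (ha : IsSymbol a F)
    (hb : IsSymbol b G) (hc : IsSymbol c H)
    (hFG : ∀ z ∈ Metric.sphere (0 : ℂ) 1, F z * G z = H z) {f : ℤ → E} (hf : IsBdd f) :
    conv a (conv b f) = conv c f := by
  rw [← conv_convMul ha.summable hb.summable hf, ((ha.mul hb).congr hFG).unique hc]

theorem IsSymbol.conv_cancel {a b : ℤ → E →L[ℂ] E} {F G : ℂ → E →L[ℂ] E} (ha : IsSymbol a F)
    (hb : IsSymbol b G) (hFG : ∀ z ∈ Metric.sphere (0 : ℂ) 1, F z * G z = 1) {f : ℤ → E}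
    (hf : IsBdd f) : conv a (conv b f) = f := by
  rw [ha.conv_conv hb isSymbol_one hFG hf, conv_single_one]

theorem conv_shift (a : ℤ → E →L[ℂ] E) (f : ℤ → E) (k n : ℤ) :
    conv (fun n => a (n - k)) f n = conv a f (n - k) := by
  unfold conv
  rw [← (Equiv.subRight k).tsum_eq (fun j => a j (f (n - k - j)))]
  simp

theorem conv_apply_eq_zero_of_nonneg {a : ℤ → E →L[ℂ] E} (ha : ∀ n < 0, a n = 0) {f : ℤ → E}
    (hf : ∀ n < 0, f n = 0) {n : ℤ} (hn : n < 0) : conv a f n = 0 := by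
  refine (tsum_congr fun j => ?_).trans tsum_zero
  rcases lt_or_ge j 0 with hj | hj
  · rw [ha j hj]; rfl
  · rw [hf _ (by omega), map_zero]

/-- Anticausality: coefficients at nonpositive indices only move a sequence backwards in time. -/
theorem conv_apply_eq_zero_of_nonpos {a : ℤ → E →L[ℂ] E} (ha : ∀ n, 0 < n → a n = 0) {f : ℤ → E}
    {c : ℤ} (hf : ∀ n, c ≤ n → f n = 0) {n : ℤ} (hn : c ≤ n) : conv a f n = 0 := by
  refine (tsum_congr fun j => ?_).trans tsum_zero
  rcases lt_or_ge 0 j with hj | hj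
  · rw [ha j hj]; rfl
  · rw [hf _ (by omega), map_zero]

end Symbols

/-! ### Toeplitz operators and their kernels -/

section ToeplitzOperators

variable {E : Type*} [NormedAddCommGroup E] [InnerProductSpace ℂ E]

/-- The extension by zero of a sequence to the integers. -/
def zeroExt (f : ℕ → E) (n : ℤ) : E := if 0 ≤ n then f n.toNat else 0

@[simp] theorem zeroExt_natCast (f : ℕ → E) (i : ℕ) : zeroExt f (i : ℤ) = f i := by
  simp [zeroExt]

theorem zeroExt_of_neg (f : ℕ → E) {n : ℤ} (hn : n < 0) : zeroExt f n = 0 := by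
  simp [zeroExt, not_le.mpr hn]

theorem zeroExt_comp_natCast {f : ℤ → E} (hf : ∀ n < 0, f n = 0) :
    zeroExt (fun i : ℕ => f i) = f := by
  funext n
  rcases lt_or_ge n 0 with hn | hn
  · rw [zeroExt_of_neg _ hn, hf n hn]
  · simp [zeroExt, hn]

theorem isBdd_zeroExt (f : lp (fun _ : ℕ => E) 2) : IsBdd (zeroExt f) := by
  refine ⟨‖f‖, fun n => ?_⟩
  unfold zeroExt
  split_ifs
  · exact lp.norm_apply_le_norm (by norm_num) f _
  · simp

theorem sum_norm_zeroExt_le (f : lp (fun _ : ℕ => E) 2) (s : Finset ℤ) :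
    ∑ n ∈ s, ‖zeroExt f n‖ ^ (2 : ENNReal).toReal ≤ ‖f‖ ^ (2 : ENNReal).toReal := by
  have h1 := lp.hasSum_norm (p := 2) (by norm_num) f
  have h2 : HasSum (fun n : ℤ => ‖zeroExt f n‖ ^ (2 : ENNReal).toReal)
      (‖f‖ ^ (2 : ENNReal).toReal) := by
    refine (Nat.cast_injective (R := ℤ)).hasSum_iff (fun n hn => ?_) |>.mp ?_
    · have hneg : n < 0 := by
        by_contra hc
        exact hn ⟨n.toNat, by omega⟩
      simp [zeroExt_of_neg _ hneg]
    · simpa [Function.comp_def] using h1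
  exact sum_le_hasSum s (fun n _ => by positivity) h2

theorem sum_norm_shift_le (n : ℤ) (A : E →L[ℂ] E) (f : lp (fun _ : ℕ => E) 2) (s : Finset ℕ) :
    ∑ i ∈ s, ‖A (zeroExt f (i - n))‖ ^ (2 : ENNReal).toReal ≤
      (‖A‖ * ‖f‖) ^ (2 : ENNReal).toReal := by
  calc ∑ i ∈ s, ‖A (zeroExt f (i - n))‖ ^ (2 : ENNReal).toReal
      ≤ ∑ i ∈ s, ‖A‖ ^ (2 : ENNReal).toReal *
          ‖zeroExt f (i - n)‖ ^ (2 : ENNReal).toReal := by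
        refine Finset.sum_le_sum fun i _ => ?_
        rw [← Real.mul_rpow (norm_nonneg _) (norm_nonneg _)]
        exact Real.rpow_le_rpow (norm_nonneg _) (A.le_opNorm _) (by norm_num)
    _ = ‖A‖ ^ (2 : ENNReal).toReal *
          ∑ m ∈ s.image fun i : ℕ => (i : ℤ) - n, ‖zeroExt f m‖ ^ (2 : ENNReal).toReal := by
        rw [← Finset.mul_sum, Finset.sum_image]
        intro i _ j _ hij
        simpa using hij
    _ ≤ ‖A‖ ^ (2 : ENNReal).toReal * ‖f‖ ^ (2 : ENNReal).toReal :=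
        mul_le_mul_of_nonneg_left (sum_norm_zeroExt_le f _) (by positivity)
    _ = _ := (Real.mul_rpow (norm_nonneg _) (norm_nonneg _)).symm

/-- The Toeplitz operator with symbol `z ^ n A`. -/
def shiftOperator (n : ℤ) (A : E →L[ℂ] E) :
    lp (fun _ : ℕ => E) 2 →L[ℂ] lp (fun _ : ℕ => E) 2 :=
  LinearMap.mkContinuous
    { toFun := fun f => ⟨fun i => A (zeroExt f (i - n)), memℓp_gen' (sum_norm_shift_le n A f)⟩
      map_add' := fun f g => by
        ext i
        simp only [zeroExt, lp.coeFn_add, Pi.add_apply]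
        split_ifs <;> simp
      map_smul' := fun c f => by
        ext i
        simp only [zeroExt, lp.coeFn_smul, Pi.smul_apply, RingHom.id_apply]
        split_ifs <;> simp } ‖A‖
    fun f => lp.norm_le_of_forall_sum_le (by norm_num) (by positivity) (sum_norm_shift_le n A f)

theorem norm_shiftOperator_le (n : ℤ) (A : E →L[ℂ] E) : ‖shiftOperator n A‖ ≤ ‖A‖ :=
  LinearMap.mkContinuous_norm_le _ (norm_nonneg _) _

variable [CompleteSpace E]

/-- The operator is the norm-convergent sum of the compressed shifts with coefficients `a n`, each
of norm at most `‖a n‖`. -/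
theorem exists_toeplitzOperator {a : ℤ → E →L[ℂ] E} {F : ℂ → E →L[ℂ] E} (h : IsSymbol a F) :
    ∃ T : lp (fun _ : ℕ => E) 2 →L[ℂ] lp (fun _ : ℕ => E) 2, IsToeplitzOperator F T ∧
      ∀ f i, T f i = conv a (zeroExt f) i := by
  have hs : Summable fun n => shiftOperator n (a n) :=
    Summable.of_norm_bounded h.summable fun n => norm_shiftOperator_le n (a n)
  refine ⟨∑' n, shiftOperator n (a n), ?_⟩
  have hT : ∀ f (i : ℕ), (∑' n, shiftOperator n (a n)) f i = conv a (zeroExt f) i := by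
    intro f i
    have h1 : HasSum (fun n => shiftOperator n (a n) f) ((∑' n, shiftOperator n (a n)) f) :=
      hs.hasSum.mapL (ContinuousLinearMap.apply ℂ _ f)
    have h2 := h1.mapL (lp.evalCLM ℂ (fun _ : ℕ => E) 2 i)
    exact h2.tsum_eq.symm
  refine ⟨fun f i => ?_, hT⟩
  rw [hT]
  have h1 := (Equiv.subLeft (i : ℤ)).hasSum_iff.mpr
    (hasSum_conv h.summable (isBdd_zeroExt f) (i : ℤ))
  have h2 := (Nat.cast_injective (R := ℤ)).hasSum_iff (fun n hn => ?_) |>.mpr h1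
  · refine hasSum_of_eq h2 fun j => ?_
    simp [h.circleCoeff]
  · have hneg : n < 0 := by
      by_contra hc
      exact hn ⟨n.toNat, by omega⟩
    simp [zeroExt_of_neg _ hneg]

theorem memℓp_two_of_summable_norm {f : ℕ → E} (hf : Summable fun n => ‖f n‖) : Memℓp f 2 :=
  Memℓp.of_exponent_ge (memℓp_gen (p := 1) (by simpa using hf)) (by norm_num)

/-- The nullity of a Toeplitz operator, computed from a linear parametrization of its kernel. -/
theorem hasToeplitzNullity_of_parametrization {a : ℤ → E →L[ℂ] E} {F : ℂ → E →L[ℂ] E}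
    (h : IsSymbol a F) {Y : Type*} [AddCommGroup Y] [Module ℂ Y] [FiniteDimensional ℂ Y]
    (Φ : Y →ₗ[ℂ] (ℤ → E)) (hinj : ∀ y, Φ y = 0 → y = 0)
    (hsum : ∀ y, Summable fun n => ‖Φ y n‖) (hneg : ∀ y, ∀ n < 0, Φ y n = 0)
    (hker : ∀ y n, 0 ≤ n → conv a (Φ y) n = 0)
    (hsurj : ∀ f, IsBdd f → (∀ n < 0, f n = 0) → (∀ n, 0 ≤ n → conv a f n = 0) → ∃ y, Φ y = f) :
    HasToeplitzNullity F (Module.finrank ℂ Y) := by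
  obtain ⟨T, hT, hTa⟩ := exists_toeplitzOperator h
  let Ψ : Y →ₗ[ℂ] lp (fun _ : ℕ => E) 2 :=
    { toFun := fun y => ⟨fun i => Φ y i,
        memℓp_two_of_summable_norm ((hsum y).comp_injective (Nat.cast_injective (R := ℤ)))⟩
      map_add' := fun x y => by ext i; simp; rfl
      map_smul' := fun c y => by ext i; simp }
  have hext : ∀ y, zeroExt (Ψ y) = Φ y := fun y => zeroExt_comp_natCast (hneg y)
  have hΨ : Function.Injective Ψ := by
    refine (injective_iff_map_eq_zero Ψ).mpr fun y hy => hinj y ?_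
    rw [← hext, hy]
    funext n
    simp [zeroExt]
  have hrange : LinearMap.range Ψ =
      LinearMap.ker (T : lp (fun _ : ℕ => E) 2 →ₗ[ℂ] lp (fun _ : ℕ => E) 2) := by
    ext f
    rw [LinearMap.mem_range, LinearMap.mem_ker]
    constructor
    · rintro ⟨y, rfl⟩
      ext i
      change T (Ψ y) i = 0
      rw [hTa, hext, hker y i (Int.natCast_nonneg i)]
    · intro hf
      -- Only the boundedness of `f` enters here; the parametrization then shows that kernel
      -- elements are absolutely summable.
      obtain ⟨y, hy⟩ := hsurj (zeroExt f) (isBdd_zeroExt f) (fun n hn => zeroExt_of_neg _ hn)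
        fun n hn => by
          lift n to ℕ using hn
          rw [← hTa]
          change T f = 0 at hf
          rw [hf]; rfl
      refine ⟨y, ?_⟩
      ext i
      have := congrFun hy i
      rwa [zeroExt_natCast] at this
  refine ⟨T, hT, ?_, ?_⟩
  · rw [← hrange]; infer_instance
  · rw [← hrange, LinearMap.finrank_range_of_inj hΨ]

theorem HasToeplitzNullity.unique {F : ℂ → E →L[ℂ] E} {n m : ℕ} (hn : HasToeplitzNullity F n)
    (hm : HasToeplitzNullity F m) : n = m := by
  obtain ⟨T, hT, -, rfl⟩ := hn
  obtain ⟨T', hT', -, rfl⟩ := hm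
  rw [hT.unique hT']

end ToeplitzOperators

/-! ### Stable operators and Stein equations -/

section Stability

variable {X Y : Type*} [NormedAddCommGroup X] [InnerProductSpace ℂ X] [CompleteSpace X]
  [FiniteDimensional ℂ X] [NormedAddCommGroup Y] [InnerProductSpace ℂ Y] [CompleteSpace Y]
  [FiniteDimensional ℂ Y]

theorem IsStable.norm_lt_one_of_mem_spectrum {A : X →L[ℂ] X} (hA : IsStable A) {c : ℂ}
    (hc : c ∈ spectrum ℂ A) : ‖c‖ < 1 := by
  refine hA c (Module.End.hasEigenvalue_iff_mem_spectrum.mpr ?_)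
  rwa [← ContinuousLinearMap.spectrum_eq]

theorem IsStable.spectralRadius_lt_one {A : X →L[ℂ] X} (hA : IsStable A) :
    spectralRadius ℂ A < 1 := by
  rcases (spectrum ℂ A).eq_empty_or_nonempty with h | h
  · simp [spectralRadius, h]
  · exact spectrum.spectralRadius_lt_of_forall_lt_of_nonempty h fun k hk =>
      hA.norm_lt_one_of_mem_spectrum hk

/-- Gelfand's formula: for `r` strictly between the spectral radius and 1, eventually `‖A ^ n‖ ≤ r ^
n`. -/
theorem IsStable.summable_norm_pow {A : X →L[ℂ] X} (hA : IsStable A) :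
    Summable fun n : ℕ => ‖A ^ n‖ := by
  obtain ⟨r, hr1, hr2⟩ := ENNReal.lt_iff_exists_nnreal_btwn.mp hA.spectralRadius_lt_one
  have hr3 : r < 1 := by exact_mod_cast hr2
  have h := spectrum.pow_nnnorm_pow_one_div_tendsto_nhds_spectralRadius A
  have h1 : ∀ᶠ n : ℕ in Filter.atTop, ‖A ^ n‖ ≤ (r : ℝ) ^ n := by
    filter_upwards [h.eventually (gt_mem_nhds hr1), Filter.eventually_gt_atTop 0] with n hn hn0
    have hn' : ((‖A ^ n‖₊ : ENNReal) ^ (1 / n : ℝ)) ^ (n : ℝ) ≤ (r : ENNReal) ^ (n : ℝ) :=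
      ENNReal.rpow_le_rpow hn.le (by positivity)
    rw [← ENNReal.rpow_mul, one_div_mul_cancel (by positivity), ENNReal.rpow_one,
      ENNReal.rpow_natCast] at hn'
    exact_mod_cast hn'
  exact Summable.of_norm_bounded_eventually_nat
    (summable_geometric_of_lt_one r.2 hr3) (by simpa using h1)

theorem IsStable.tendsto_norm_pow {A : X →L[ℂ] X} (hA : IsStable A) :
    Filter.Tendsto (fun n : ℕ => ‖A ^ n‖) Filter.atTop (nhds 0) :=
  hA.summable_norm_pow.tendsto_atTop_zero

theorem IsStable.exists_norm_pow_le {A : X →L[ℂ] X} (hA : IsStable A) :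
    ∃ M : ℝ, ∀ n : ℕ, ‖A ^ n‖ ≤ M :=
  ⟨∑' n, ‖A ^ n‖, fun n => hA.summable_norm_pow.le_tsum n fun _ _ => norm_nonneg _⟩

theorem IsStable.hasSum_geometric {A : X →L[ℂ] X} (hA : IsStable A) {z : ℂ} (hz : ‖z‖ ≤ 1) :
    HasSum (fun n : ℕ => z ^ n • A ^ n) (Ring.inverse (1 - z • A)) ∧ IsUnit (1 - z • A) := by
  have hs : Summable fun n : ℕ => (z • A) ^ n := by
    refine Summable.of_norm_bounded hA.summable_norm_pow fun n => ?_
    rw [smul_pow, norm_smul, norm_pow]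
    exact mul_le_of_le_one_left (norm_nonneg _) (pow_le_one₀ (norm_nonneg _) hz)
  let u : (X →L[ℂ] X)ˣ :=
    ⟨1 - z • A, ∑' n : ℕ, (z • A) ^ n, hs.one_sub_mul_tsum_pow, hs.tsum_pow_mul_one_sub⟩
  have hu : Ring.inverse (1 - z • A) = ∑' n : ℕ, (z • A) ^ n := Ring.inverse_unit u
  refine ⟨?_, u.isUnit⟩
  rw [hu]
  simpa only [smul_pow] using hs.hasSum

theorem norm_adjoint_pow (A : X →L[ℂ] X) (n : ℕ) : ‖A.adjoint ^ n‖ = ‖A ^ n‖ := by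
  rw [← ContinuousLinearMap.star_eq_adjoint, ← star_pow, norm_star]

theorem norm_pow_comp_comp_pow_le (A : Y →L[ℂ] Y) (A' : X →L[ℂ] X) (K : X →L[ℂ] Y) (n : ℕ) :
    ‖(A ^ n) ∘L K ∘L (A'.adjoint ^ n)‖ ≤ ‖A ^ n‖ * (‖K‖ * ‖A' ^ n‖) := by
  rw [← norm_adjoint_pow A']
  exact (ContinuousLinearMap.opNorm_comp_le _ _).trans
    (mul_le_mul_of_nonneg_left (ContinuousLinearMap.opNorm_comp_le _ _) (norm_nonneg _))

/-- Iteration gives `Δ = A^n Δ (A'^*)^n`, and the right-hand side tends to 0. -/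
theorem stein_homogeneous {A : Y →L[ℂ] Y} {A' : X →L[ℂ] X} (hA : IsStable A) (hA' : IsStable A')
    {Δ : X →L[ℂ] Y} (h : Δ = A ∘L Δ ∘L A'.adjoint) : Δ = 0 := by
  have hn : ∀ n : ℕ, Δ = (A ^ n) ∘L Δ ∘L (A'.adjoint ^ n) := by
    intro n
    induction n with
    | zero => ext x; simp
    | succ n ih =>
      have h1 : ∀ x, Δ x = (A ^ n) (Δ ((A'.adjoint ^ n) x)) := fun x => DFunLike.congr_fun ih x
      have h2 : ∀ x, Δ x = A (Δ (A'.adjoint x)) := fun x => DFunLike.congr_fun h x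
      ext x
      rw [h1, h2, pow_succ, pow_succ']
      rfl
  rw [← norm_le_zero_iff]
  have hlim : Filter.Tendsto (fun n : ℕ => ‖A ^ n‖ * (‖Δ‖ * ‖A' ^ n‖)) Filter.atTop (nhds 0) := by
    simpa using hA.tendsto_norm_pow.mul (hA'.tendsto_norm_pow.const_mul ‖Δ‖)
  refine ge_of_tendsto' hlim fun n => ?_
  nth_rw 1 [hn n]
  exact norm_pow_comp_comp_pow_le A A' Δ n

theorem stein_unique {A : Y →L[ℂ] Y} {A' : X →L[ℂ] X} (hA : IsStable A) (hA' : IsStable A')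
    {K Ω Ω' : X →L[ℂ] Y} (h : Ω = A ∘L Ω ∘L A'.adjoint + K)
    (h' : Ω' = A ∘L Ω' ∘L A'.adjoint + K) : Ω = Ω' := by
  rw [← sub_eq_zero]
  refine stein_homogeneous hA hA' ?_
  nth_rw 1 [h, h']
  ext x
  simp

/-- The series is the solution: conjugating it by `A` and `A'^*` removes its zeroth term `K`. -/
theorem exists_stein_hasSum {A : Y →L[ℂ] Y} {A' : X →L[ℂ] X} (hA : IsStable A)
    (hA' : IsStable A') (K : X →L[ℂ] Y) :
    ∃ Ω : X →L[ℂ] Y, Ω = A ∘L Ω ∘L A'.adjoint + K ∧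
      HasSum (fun n : ℕ => (A ^ n) ∘L K ∘L (A'.adjoint ^ n)) Ω := by
  obtain ⟨M, hM⟩ := hA'.exists_norm_pow_le
  have hs : Summable fun n : ℕ => (A ^ n) ∘L K ∘L (A'.adjoint ^ n) :=
    Summable.of_norm_bounded (hA.summable_norm_pow.mul_right (‖K‖ * M)) fun n =>
      (norm_pow_comp_comp_pow_le A A' K n).trans (by gcongr; exact hM n)
  refine ⟨_, ?_, hs.hasSum⟩
  have hstep : ∑' n : ℕ, (A ^ (n + 1)) ∘L K ∘L (A'.adjoint ^ (n + 1)) =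
      A ∘L (∑' n : ℕ, (A ^ n) ∘L K ∘L (A'.adjoint ^ n)) ∘L A'.adjoint := by
    have h1 := (hs.hasSum.mapL (ContinuousLinearMap.compL ℂ X Y Y A)).mapL
      ((ContinuousLinearMap.compL ℂ X X Y).flip A'.adjoint)
    refine (hasSum_of_eq h1 fun n => ?_).tsum_eq
    ext x
    simp [pow_succ', pow_succ A'.adjoint]
  nth_rw 1 [hs.tsum_eq_zero_add]
  rw [hstep, add_comm]
  ext x
  simp

theorem existsUnique_stein {A : Y →L[ℂ] Y} {A' : X →L[ℂ] X} (hA : IsStable A)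
    (hA' : IsStable A') (K : X →L[ℂ] Y) : ∃! Ω : X →L[ℂ] Y, Ω = A ∘L Ω ∘L A'.adjoint + K := by
  obtain ⟨Ω, hΩ, -⟩ := exists_stein_hasSum hA hA' K
  exact ⟨Ω, hΩ, fun Ω' h' => stein_unique hA hA' h' hΩ⟩

theorem hasSum_of_stein {A : Y →L[ℂ] Y} {A' : X →L[ℂ] X} (hA : IsStable A) (hA' : IsStable A')
    {K Ω : X →L[ℂ] Y} (h : Ω = A ∘L Ω ∘L A'.adjoint + K) :
    HasSum (fun n : ℕ => (A ^ n) ∘L K ∘L (A'.adjoint ^ n)) Ω := by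
  obtain ⟨Ω', h', hs⟩ := exists_stein_hasSum hA hA' K
  rwa [stein_unique hA hA' h h']

end Stability

/-! ### Isometry and coisometry relations of a unitary system -/

section UnitarySystems

variable {X E : Type*} [NormedAddCommGroup X] [InnerProductSpace ℂ X] [CompleteSpace X]
  [NormedAddCommGroup E] [InnerProductSpace ℂ E] [CompleteSpace E]
  {A : X →L[ℂ] X} {B : E →L[ℂ] X} {C : X →L[ℂ] E} {D : E →L[ℂ] E}

theorem systemsOperator_apply (p : WithLp 2 (X × E)) :
    systemsOperator A B C D p = WithLp.toLp 2 (A p.fst + B p.snd, C p.fst + D p.snd) := rfl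

theorem inner_systemsOperator (hU : systemsOperator A B C D ∈ unitary _) (x y : X) (u v : E) :
    ⟪A x + B u, A y + B v⟫_ℂ + ⟪C x + D u, C y + D v⟫_ℂ = ⟪x, y⟫_ℂ + ⟪u, v⟫_ℂ := by
  have h : ⟪systemsOperator A B C D (WithLp.toLp 2 (x, u)),
      systemsOperator A B C D (WithLp.toLp 2 (y, v))⟫_ℂ =
        ⟪WithLp.toLp 2 (x, u), WithLp.toLp 2 (y, v)⟫_ℂ := by
    rw [← ContinuousLinearMap.adjoint_inner_right, ← ContinuousLinearMap.star_eq_adjoint,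
      ← mul_apply_eq_comp, Unitary.star_mul_self_of_mem hU,
      one_apply_eq_self]
  simp only [systemsOperator_apply, WithLp.prod_inner_apply] at h
  exact h

theorem systemsOperator_adjoint_apply (x : X) :
    (systemsOperator A B C D).adjoint (WithLp.toLp 2 (x, 0)) =
      WithLp.toLp 2 (A.adjoint x, B.adjoint x) := by
  refine ext_inner_right ℂ fun p => ?_
  rw [ContinuousLinearMap.adjoint_inner_left, systemsOperator_apply]
  simp [WithLp.prod_inner_apply, ContinuousLinearMap.adjoint_inner_left, inner_add_right]

theorem systemsOperator_coisometry (hU : systemsOperator A B C D ∈ unitary _) (x : X) :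
    A (A.adjoint x) + B (B.adjoint x) = x ∧ C (A.adjoint x) + D (B.adjoint x) = 0 := by
  have h : systemsOperator A B C D ((systemsOperator A B C D).adjoint (WithLp.toLp 2 (x, 0))) =
      WithLp.toLp 2 (x, 0) := by
    rw [← ContinuousLinearMap.star_eq_adjoint, ← mul_apply_eq_comp,
      Unitary.mul_star_self_of_mem hU, one_apply_eq_self]
  rw [systemsOperator_adjoint_apply, systemsOperator_apply] at h
  have h' := (WithLp.toLp_injective 2) h
  exact ⟨congrArg Prod.fst h', congrArg Prod.snd h'⟩

end UnitarySystems

/-! ### Transfer functions as input-output maps of linear systems -/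

section Markov

variable {X E : Type*} [NormedAddCommGroup X] [InnerProductSpace ℂ X] [CompleteSpace X]
  [FiniteDimensional ℂ X] [NormedAddCommGroup E] [InnerProductSpace ℂ E] [CompleteSpace E]
  [FiniteDimensional ℂ E]
  {A : X →L[ℂ] X} {B : E →L[ℂ] X} {C : X →L[ℂ] E} {D : E →L[ℂ] E} {V : ℂ → E →L[ℂ] E}

/-- The Taylor coefficients of the transfer function `D + z C (1 - z A)⁻¹ B`. -/
def markov (A : X →L[ℂ] X) (B : E →L[ℂ] X) (C : X →L[ℂ] E) (D : E →L[ℂ] E) (n : ℤ) : E →L[ℂ] E :=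
  if n < 0 then 0 else if n = 0 then D else C ∘L (A ^ (n - 1).toNat) ∘L B

theorem markov_of_neg {n : ℤ} (hn : n < 0) : markov A B C D n = 0 := if_pos hn

theorem markov_zero : markov A B C D 0 = D := by simp [markov]

theorem markov_succ (n : ℕ) : markov A B C D (n + 1) = C ∘L (A ^ n) ∘L B := by
  rw [markov, if_neg (by omega), if_neg (by omega), add_sub_cancel_right, Int.toNat_natCast]

/-- Sums over the integers of families supported on the natural numbers. -/
theorem hasSum_int_of_nat_succ {G : Type*} [AddCommGroup G] [TopologicalSpace G]
    [IsTopologicalAddGroup G] {f : ℤ → G} (hf : ∀ n < 0, f n = 0) {x : G}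
    (h : HasSum (fun n : ℕ => f (n + 1)) x) : HasSum f (f 0 + x) := by
  refine (Nat.cast_injective (R := ℤ)).hasSum_iff (fun n hn => hf n ?_) |>.mp ?_
  · by_contra hc
    exact hn ⟨n.toNat, by omega⟩
  · refine (hasSum_nat_add_iff' 1).mp ?_
    simpa using h

theorem summable_norm_markov (hA : IsStable A) : Summable fun n => ‖markov A B C D n‖ := by
  have h : Summable fun n : ℕ => ‖markov A B C D (n + 1)‖ := by
    refine Summable.of_nonneg_of_le (fun _ => norm_nonneg _) (fun n => ?_)
      ((hA.summable_norm_pow.mul_right ‖B‖).mul_left ‖C‖)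
    rw [markov_succ]
    exact (ContinuousLinearMap.opNorm_comp_le _ _).trans
      (mul_le_mul_of_nonneg_left (ContinuousLinearMap.opNorm_comp_le _ _) (norm_nonneg _))
  exact (hasSum_int_of_nat_succ (f := fun n => ‖markov A B C D n‖)
    (fun n hn => by rw [markov_of_neg hn, norm_zero]) h.hasSum).summable

theorem isSymbol_markov (hA : IsStable A) :
    IsSymbol (markov A B C D) fun z => D + z • (C ∘L Ring.inverse (1 - z • A) ∘L B) where
  summable := summable_norm_markov hA
  hasSum z hz := by
    have h1 := (((hA.hasSum_geometric (mem_sphere_zero_iff_norm.mp hz).le).1.mapL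
      (ContinuousLinearMap.compL ℂ X X E C)).mapL
      ((ContinuousLinearMap.compL ℂ E X E).flip B)).const_smul z
    have h2 := hasSum_int_of_nat_succ (f := fun n : ℤ => z ^ n • markov A B C D n)
      (fun n hn => by rw [markov_of_neg hn, smul_zero]) (hasSum_of_eq h1 fun n => ?_)
    · rw [markov_zero, zpow_zero, one_smul] at h2
      exact h2
    · rw [markov_succ]
      have : z ^ ((n : ℤ) + 1) = z * z ^ n := by
        rw [zpow_add₀ (ne_zero_of_mem_sphere_one hz), zpow_natCast, zpow_one, mul_comm]
      rw [this]
      ext u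
      simp [smul_smul]

theorem differentiableOn_transfer (hA : IsStable A) :
    DifferentiableOn ℂ (fun z : ℂ => D + z • (C ∘L Ring.inverse (1 - z • A) ∘L B))
      (Metric.closedBall 0 1) := by
  have h := spectrum.differentiableOn_inverse_one_sub_smul (a := A) (r := 1)
    (by simpa using ENNReal.one_lt_inv.mpr hA.spectralRadius_lt_one)
  have h1 : DifferentiableOn ℂ (fun z : ℂ => (C ∘L Ring.inverse (1 - z • A) ∘L B))
      (Metric.closedBall 0 1) := by
    have h2 := ((ContinuousLinearMap.compL ℂ E X E).flip B).differentiable.comp_differentiableOn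
      ((ContinuousLinearMap.compL ℂ X X E C).differentiable.comp_differentiableOn h)
    exact h2
  exact (differentiableOn_id.smul h1).const_add D

theorem IsRationalOn.continuousOn {F : ℂ → E →L[ℂ] E} {S : Set ℂ} (h : IsRationalOn F S) :
    ContinuousOn F S := by
  obtain ⟨q, n, P, hP⟩ := h
  have : ContinuousOn (fun z => (q.eval z)⁻¹ • ∑ i ∈ Finset.range n, z ^ i • P i) S := by
    refine ContinuousOn.smul (q.continuous.continuousOn.inv₀ fun z hz => (hP z hz).1) ?_
    fun_prop
  exact this.congr fun z hz => (hP z hz).2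

/-- The identity theorem extends the realization from a neighborhood of 0 to the open disc.
Continuity carries it to the circle: rationality provides it for `V`, stability for the transfer
function. -/
theorem IsStableUnitaryRealization.eq_transfer (h : IsStableUnitaryRealization A B C D V)
    (hrat : IsRationalOn V (Metric.closedBall 0 1))
    (hV : IsBiInner V) :
    Set.EqOn V (fun z => D + z • (C ∘L Ring.inverse (1 - z • A) ∘L B))
      (Metric.closedBall 0 1) := by
  have hd := differentiableOn_transfer (B := B) (C := C) (D := D) h.stable
  have h1 : Set.EqOn V (fun z => D + z • (C ∘L Ring.inverse (1 - z • A) ∘L B))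
      (Metric.ball 0 1) :=
    (hV.differentiableOn.analyticOnNhd Metric.isOpen_ball).eqOn_of_preconnected_of_eventuallyEq
      ((hd.mono Metric.ball_subset_closedBall).analyticOnNhd Metric.isOpen_ball)
      (convex_ball (0 : ℂ) 1).isPreconnected (Metric.mem_ball_self one_pos) h.realization
  refine h1.of_subset_closure hrat.continuousOn hd.continuousOn Metric.ball_subset_closedBall ?_
  rw [closure_ball _ one_ne_zero]

theorem IsStableUnitaryRealization.isSymbol (h : IsStableUnitaryRealization A B C D V)
    (hrat : IsRationalOn V (Metric.closedBall 0 1)) (hV : IsBiInner V) :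
    IsSymbol (markov A B C D) V :=
  (isSymbol_markov h.stable).congr fun _ hz =>
    (h.eq_transfer hrat hV (Metric.sphere_subset_closedBall hz)).symm

/-- With input `u` and state `z (1 - zA)⁻¹ B u`, the next state is `(1 - zA)⁻¹ B u` and the output
is `V z u`. Since `|z| = 1`, the state contributions to the isometry relation cancel. -/
theorem IsStableUnitaryRealization.adjoint_mul_self (h : IsStableUnitaryRealization A B C D V)
    (hrat : IsRationalOn V (Metric.closedBall 0 1)) (hV : IsBiInner V) {z : ℂ}
    (hz : z ∈ Metric.sphere (0 : ℂ) 1) : (V z).adjoint * V z = 1 := by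
  have hz1 := mem_sphere_zero_iff_norm.mp hz
  have hu := (h.stable.hasSum_geometric hz1.le).2
  have hstate : ∀ u, A (z • (Ring.inverse (1 - z • A)) (B u)) + B u =
      (Ring.inverse (1 - z • A)) (B u) := by
    intro u
    have h1 := DFunLike.congr_fun (Ring.mul_inverse_cancel _ hu) (B u)
    simp only [mul_apply_eq_comp, sub_apply, one_apply_eq_self, smul_apply] at h1
    rw [map_smul]
    nth_rw 2 [← h1]
    abel
  have hout : ∀ u, C (z • (Ring.inverse (1 - z • A)) (B u)) + D u = V z u := by
    intro u
    rw [h.eq_transfer hrat hV (Metric.sphere_subset_closedBall hz)]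
    simp [add_comm]
  ext u
  refine ext_inner_left ℂ fun v => ?_
  have h2 := inner_systemsOperator h.isUnitary (z • (Ring.inverse (1 - z • A)) (B v))
    (z • (Ring.inverse (1 - z • A)) (B u)) v u
  rw [hstate, hstate, hout, hout, inner_smul_left, inner_smul_right, ← mul_assoc,
    mul_comm (starRingEnd ℂ z), Complex.mul_conj, Complex.normSq_eq_norm_sq, hz1] at h2
  simpa [ContinuousLinearMap.adjoint_inner_right] using h2

theorem IsStableUnitaryRealization.mul_adjoint_self (h : IsStableUnitaryRealization A B C D V)
    (hrat : IsRationalOn V (Metric.closedBall 0 1)) (hV : IsBiInner V) {z : ℂ}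
    (hz : z ∈ Metric.sphere (0 : ℂ) 1) : V z * (V z).adjoint = 1 := by
  have h1 := congrArg (fun T : E →L[ℂ] E => (T : E →ₗ[ℂ] E)) (h.adjoint_mul_self hrat hV hz)
  have h2 : ((V z : E →ₗ[ℂ] E) * ((V z).adjoint : E →ₗ[ℂ] E)) = 1 :=
    (mul_eq_one_comm (M := Module.End ℂ E)).mp h1
  ext u
  exact DFunLike.congr_fun h2 u

/-- The state at time `n` of the stable linear system driven by the bounded input `h`. -/
def stateSeq (A : X →L[ℂ] X) (B : E →L[ℂ] X) (h : ℤ → E) (n : ℤ) : X :=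
  ∑' m : ℕ, (A ^ m) (B (h (n - 1 - m)))

theorem hasSum_stateSeq (hA : IsStable A) {h : ℤ → E} (hh : IsBdd h) (n : ℤ) :
    HasSum (fun m : ℕ => (A ^ m) (B (h (n - 1 - m)))) (stateSeq A B h n) := by
  obtain ⟨M, hM⟩ := hh
  refine (Summable.of_norm_bounded (hA.summable_norm_pow.mul_right (‖B‖ * M)) fun m => ?_).hasSum
  exact ((A ^ m).le_opNorm _).trans (mul_le_mul_of_nonneg_left ((B.le_opNorm _).trans
    (mul_le_mul_of_nonneg_left (hM _) (norm_nonneg _))) (norm_nonneg _))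

/-- Convolution runs the system over all of `ℤ`: the state collects the past inputs, and the output
is read from it. Stability makes this meaningful for inputs without a starting time. -/
theorem conv_markov (hA : IsStable A) {h : ℤ → E} (hh : IsBdd h) (n : ℤ) :
    conv (markov A B C D) h n = D (h n) + C (stateSeq A B h n) := by
  have h1 := hasSum_int_of_nat_succ (f := fun j => markov A B C D j (h (n - j)))
    (fun j hj => by rw [markov_of_neg hj]; rfl)
    (hasSum_of_eq ((hasSum_stateSeq (B := B) hA hh n).mapL C) fun m => ?_)
  · rw [conv, h1.tsum_eq, markov_zero, sub_zero]
  · rw [markov_succ, sub_sub, add_comm (1 : ℤ)]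
    rfl

theorem stateSeq_succ (hA : IsStable A) {h : ℤ → E} (hh : IsBdd h) (n : ℤ) :
    stateSeq A B h (n + 1) = B (h n) + A (stateSeq A B h n) := by
  have h1 := (hasSum_nat_add_iff' 1).mpr (hasSum_stateSeq (B := B) hA hh (n + 1))
  have h2 := (hasSum_stateSeq (B := B) hA hh n).mapL A
  have h3 := h1.unique (hasSum_of_eq h2 fun m => ?_)
  · simp only [Finset.range_one, Finset.sum_singleton, pow_zero, Nat.cast_zero, sub_zero,
      add_sub_cancel_right, one_apply_eq_self] at h3
    rw [← h3]
    abel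
  · rw [pow_succ', mul_apply_eq_comp]
    congr 4
    push_cast
    ring

theorem stateSeq_natCast (hA : IsStable A) {h : ℤ → E} (hh : IsBdd h)
    (hneg : ∀ n, 0 ≤ n → h n = 0) (n : ℕ) : stateSeq A B h n = (A ^ n) (stateSeq A B h 0) := by
  induction n with
  | zero => simp
  | succ n ih =>
    rw [Nat.cast_succ, stateSeq_succ hA hh, hneg n (by omega), ih, pow_succ', map_zero, zero_add]
    rfl

/-- Once the input stops at time 0, the system evolves freely from its state at that time. -/
theorem conv_markov_natCast (hA : IsStable A) {h : ℤ → E} (hh : IsBdd h)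
    (hneg : ∀ n, 0 ≤ n → h n = 0) (n : ℕ) :
    conv (markov A B C D) h n = C ((A ^ n) (stateSeq A B h 0)) := by
  rw [conv_markov hA hh, hneg n (by omega), map_zero, zero_add, stateSeq_natCast hA hh hneg]

/-- With zero input and zero output the isometry keeps `‖A^n x‖` constant, while stability sends it
to 0. -/
theorem observable (hA : IsStable A) (hU : systemsOperator A B C D ∈ unitary _) {x : X}
    (hx : ∀ n : ℕ, C ((A ^ n) x) = 0) : x = 0 := by
  have hn : ∀ n : ℕ, ‖(A ^ n) x‖ ^ 2 = ‖x‖ ^ 2 := by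
    intro n
    induction n with
    | zero => simp
    | succ n ih =>
      have h1 := inner_systemsOperator hU ((A ^ n) x) ((A ^ n) x) 0 0
      simp only [map_zero, add_zero, hx n, inner_self_eq_norm_sq_to_K] at h1
      have h2 : (A ^ (n + 1)) x = A ((A ^ n) x) := by rw [pow_succ']; rfl
      rw [← ih, h2]
      norm_cast at h1
      simpa using h1
  have hlim : Filter.Tendsto (fun n : ℕ => (‖A ^ n‖ * ‖x‖) ^ 2) Filter.atTop (nhds 0) := by
    simpa using (hA.tendsto_norm_pow.mul_const ‖x‖).pow 2
  have hle : ‖x‖ ^ 2 ≤ 0 := ge_of_tendsto' hlim fun n => by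
    rw [← hn n]
    exact pow_le_pow_left₀ (norm_nonneg _) ((A ^ n).le_opNorm x) 2
  exact norm_eq_zero.mp (pow_eq_zero_iff two_ne_zero |>.mp (le_antisymm hle (sq_nonneg _)))

end Markov

/-! ### The operators `Ω`, `C₀` and `Q`, and the canonical input -/

section SteinSolution

variable {E Xv Xw : Type*}
  [NormedAddCommGroup E] [InnerProductSpace ℂ E] [FiniteDimensional ℂ E] [CompleteSpace E]
  [NormedAddCommGroup Xv] [InnerProductSpace ℂ Xv] [FiniteDimensional ℂ Xv] [CompleteSpace Xv]
  [NormedAddCommGroup Xw] [InnerProductSpace ℂ Xw] [FiniteDimensional ℂ Xw] [CompleteSpace Xw]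
  {Av : Xv →L[ℂ] Xv} {Bv : E →L[ℂ] Xv} {Cv : Xv →L[ℂ] E} {Dv : E →L[ℂ] E}
  {Aw : Xw →L[ℂ] Xw} {Bw : E →L[ℂ] Xw} {Cw : Xw →L[ℂ] E} {Dw : E →L[ℂ] E}
  {Ω : Xw →L[ℂ] Xv} {C₀ : Xw →L[ℂ] E} {Q : Xw →L[ℂ] Xw}

/-- The system of `V` sends `(Ω A_w^* x, B_w^* x)` to `(Ω x, C₀ x)` isometrically. Replacing `B_w
B_w^*` by `1 - A_w A_w^*`, from the coisometry of `W`, gives the identity. -/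
theorem stein_one_sub_adjoint_comp (hUv : systemsOperator Av Bv Cv Dv ∈ unitary _)
    (hUw : systemsOperator Aw Bw Cw Dw ∈ unitary _)
    (hΩ : Ω = Av ∘L Ω ∘L Aw.adjoint + Bv ∘L Bw.adjoint)
    (hC : C₀ = Dv ∘L Bw.adjoint + Cv ∘L Ω ∘L Aw.adjoint) :
    1 - Ω.adjoint ∘L Ω = Aw ∘L (1 - Ω.adjoint ∘L Ω) ∘L Aw.adjoint + C₀.adjoint ∘L C₀ := by
  have h1 : ∀ x, Ω x = Av (Ω (Aw.adjoint x)) + Bv (Bw.adjoint x) := fun x =>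
    DFunLike.congr_fun hΩ x
  have h2 : ∀ x, C₀ x = Cv (Ω (Aw.adjoint x)) + Dv (Bw.adjoint x) := fun x => by
    rw [hC, add_comm]; rfl
  ext x
  refine ext_inner_left ℂ fun y => ?_
  have h3 := inner_systemsOperator hUv (Ω (Aw.adjoint y)) (Ω (Aw.adjoint x)) (Bw.adjoint y)
    (Bw.adjoint x)
  rw [← h1, ← h1, ← h2, ← h2] at h3
  have h4 : ⟪y, x⟫_ℂ = ⟪Aw.adjoint y, Aw.adjoint x⟫_ℂ + ⟪Bw.adjoint y, Bw.adjoint x⟫_ℂ := by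
    nth_rw 1 [← (systemsOperator_coisometry hUw x).1]
    rw [inner_add_right, ContinuousLinearMap.adjoint_inner_left,
      ContinuousLinearMap.adjoint_inner_left]
  simp only [sub_apply, add_apply, ContinuousLinearMap.comp_apply, one_apply_eq_self,
    inner_sub_right, inner_add_right]
  rw [← ContinuousLinearMap.adjoint_inner_left Aw, inner_sub_right,
    ContinuousLinearMap.adjoint_inner_right Ω, ContinuousLinearMap.adjoint_inner_right Ω,
    ContinuousLinearMap.adjoint_inner_right C₀, h4]
  linear_combination -h3

theorem stein_iterate (hQ : Q = Aw ∘L Q ∘L Aw.adjoint + C₀.adjoint ∘L C₀) (k : ℕ) (x y : Xw) :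
    ⟪y, Q x⟫_ℂ = ⟪y, (Aw ^ k * Q * Aw.adjoint ^ k) x⟫_ℂ +
      ∑ j ∈ Finset.range k, ⟪C₀ ((Aw.adjoint ^ j) y), C₀ ((Aw.adjoint ^ j) x)⟫_ℂ := by
  have hadj : ∀ (k : ℕ) (u v : Xw), ⟪u, (Aw ^ k) v⟫_ℂ = ⟪(Aw.adjoint ^ k) u, v⟫_ℂ := by
    intro k u v
    rw [← ContinuousLinearMap.star_eq_adjoint, ← star_pow, ContinuousLinearMap.star_eq_adjoint,
      ContinuousLinearMap.adjoint_inner_left]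
  have hQ' : ∀ u v, ⟪u, Q v⟫_ℂ = ⟪Aw.adjoint u, Q (Aw.adjoint v)⟫_ℂ + ⟪C₀ u, C₀ v⟫_ℂ := by
    intro u v
    nth_rw 1 [hQ]
    simp only [add_apply, ContinuousLinearMap.comp_apply, inner_add_right,
      ContinuousLinearMap.adjoint_inner_right]
    rw [← ContinuousLinearMap.adjoint_inner_left Aw]
  induction k with
  | zero => simp
  | succ k ih =>
    rw [ih, Finset.sum_range_succ]
    simp only [mul_apply_eq_comp, hadj]
    rw [hQ', pow_succ']
    simp only [mul_apply_eq_comp]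
    ring

/-- The defect operator is `Ω^* Ω + ∑_{j<k} A_w^j C₀^* C₀ (A_w^*)^j`; its quadratic form at `x` is a
sum of squares, so each square vanishes on the kernel. -/
theorem mem_ker_defect_iff (hQ : Q = Aw ∘L Q ∘L Aw.adjoint + C₀.adjoint ∘L C₀)
    (hQΩ : Q = 1 - Ω.adjoint ∘L Ω) (k : ℕ) (x : Xw) :
    (1 - Aw ^ k * Q * Aw.adjoint ^ k) x = 0 ↔
      Ω x = 0 ∧ ∀ j < k, C₀ ((Aw.adjoint ^ j) x) = 0 := by
  have key : ∀ y, ⟪y, (1 - Aw ^ k * Q * Aw.adjoint ^ k) x⟫_ℂ = ⟪Ω y, Ω x⟫_ℂ +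
      ∑ j ∈ Finset.range k, ⟪C₀ ((Aw.adjoint ^ j) y), C₀ ((Aw.adjoint ^ j) x)⟫_ℂ := by
    intro y
    have h1 := stein_iterate hQ k x y
    have h2 : ⟪y, Q x⟫_ℂ = ⟪y, x⟫_ℂ - ⟪Ω y, Ω x⟫_ℂ := by
      rw [hQΩ]
      simp [ContinuousLinearMap.adjoint_inner_right]
    rw [sub_apply, one_apply_eq_self, inner_sub_right]
    linear_combination h1 - h2
  constructor
  · intro h
    have h1 := key x
    simp only [h, inner_zero_right, inner_self_eq_norm_sq_to_K] at h1
    have h2 : ‖Ω x‖ ^ 2 + ∑ j ∈ Finset.range k, ‖C₀ ((Aw.adjoint ^ j) x)‖ ^ 2 = 0 :=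
      (RCLike.ofReal_eq_zero (K := ℂ)).mp (by exact_mod_cast h1.symm)
    have h3 : 0 ≤ ∑ j ∈ Finset.range k, ‖C₀ ((Aw.adjoint ^ j) x)‖ ^ 2 :=
      Finset.sum_nonneg fun _ _ => sq_nonneg _
    have h4 := sq_nonneg ‖Ω x‖
    refine ⟨by simpa using (show ‖Ω x‖ ^ 2 = 0 by linarith), fun j hj => ?_⟩
    have h5 := (Finset.sum_eq_zero_iff_of_nonneg fun _ _ => sq_nonneg _).mp
      (show ∑ j ∈ Finset.range k, ‖C₀ ((Aw.adjoint ^ j) x)‖ ^ 2 = 0 by linarith) j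
      (Finset.mem_range.mpr hj)
    simpa using h5
  · rintro ⟨h1, h2⟩
    refine ext_inner_left ℂ fun y => ?_
    rw [key, h1, inner_zero_right, inner_zero_right, zero_add]
    exact Finset.sum_eq_zero fun j hj => by
      rw [h2 j (Finset.mem_range.mp hj), inner_zero_right]

theorem isPositive_of_stein (hA : IsStable Aw)
    (hQ : Q = Aw ∘L Q ∘L Aw.adjoint + C₀.adjoint ∘L C₀) : Q.IsPositive := by
  have hpos : ∀ n : ℕ, 0 ≤ (Aw ^ n) ∘L (C₀.adjoint ∘L C₀) ∘L (Aw.adjoint ^ n) := by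
    intro n
    rw [ContinuousLinearMap.nonneg_iff_isPositive]
    have h := (ContinuousLinearMap.isPositive_adjoint_comp_self C₀).conj_adjoint (Aw ^ n)
    rwa [← ContinuousLinearMap.star_eq_adjoint (Aw ^ n), star_pow,
      ContinuousLinearMap.star_eq_adjoint] at h
  have hsum := hasSum_of_stein hA hA hQ
  rw [← ContinuousLinearMap.nonneg_iff_isPositive]
  exact hsum.nonneg hpos

theorem norm_le_one_of_eq_one_sub (hpos : Q.IsPositive) (hQΩ : Q = 1 - Ω.adjoint ∘L Ω) :
    ‖Q‖ ≤ 1 := by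
  refine (CStarAlgebra.norm_le_one_iff_of_nonneg Q
    ((ContinuousLinearMap.nonneg_iff_isPositive Q).mpr hpos)).mpr ?_
  rw [ContinuousLinearMap.le_def, hQΩ, sub_sub_cancel]
  exact ContinuousLinearMap.isPositive_adjoint_comp_self Ω

/-- Algebraic multiplicity is the dimension of the generalized eigenspace, which for a symmetric
operator is the eigenspace. -/
theorem rootMultiplicity_charpoly_eq_finrank_ker (hpos : Q.IsPositive) :
    (Q : Xw →ₗ[ℂ] Xw).charpoly.rootMultiplicity 1 =
      Module.finrank ℂ (LinearMap.ker ((1 - Q : Xw →L[ℂ] Xw) : Xw →ₗ[ℂ] Xw)) := by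
  rw [← LinearMap.finrank_maxGenEigenspace_eq,
    Module.End.IsFinitelySemisimple.maxGenEigenspace_eq_eigenspace
      hpos.isSymmetric.isFinitelySemisimple]
  have h : Module.End.eigenspace (Q : Xw →ₗ[ℂ] Xw) 1 =
      LinearMap.ker ((1 - Q : Xw →L[ℂ] Xw) : Xw →ₗ[ℂ] Xw) := by
    ext x
    rw [Module.End.mem_eigenspace_iff, LinearMap.mem_ker, one_smul, eq_comm, ← sub_eq_zero]
    rfl
  rw [h]

/-- The input sequence `h_{-n} = B^* (A^*)^(n-1) x`, `n ≥ 1`. -/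
def inputSeq (A : Xw →L[ℂ] Xw) (B : E →L[ℂ] Xw) : Xw →ₗ[ℂ] (ℤ → E) :=
  LinearMap.pi fun n =>
    if n < 0 then ((B.adjoint ∘L A.adjoint ^ (-n - 1).toNat : Xw →L[ℂ] E) : Xw →ₗ[ℂ] E) else 0

theorem inputSeq_of_nonneg (x : Xw) {n : ℤ} (hn : 0 ≤ n) : inputSeq Aw Bw x n = 0 := by
  simp [inputSeq, not_lt.mpr hn]

theorem inputSeq_negSucc (x : Xw) (m : ℕ) :
    inputSeq Aw Bw x (-1 - m) = Bw.adjoint ((Aw.adjoint ^ m) x) := by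
  have h1 : (-1 - m : ℤ) < 0 := by omega
  have h2 : (-(-1 - m : ℤ) - 1).toNat = m := by omega
  simp only [inputSeq, LinearMap.pi_apply, if_pos h1, h2]
  rfl

theorem isBdd_inputSeq (hA : IsStable Aw) (x : Xw) : IsBdd (inputSeq Aw Bw x) := by
  obtain ⟨M, hM⟩ := hA.exists_norm_pow_le
  have hM0 : 0 ≤ M := (norm_nonneg _).trans (hM 0)
  refine ⟨‖Bw.adjoint‖ * (M * ‖x‖), fun n => ?_⟩
  rcases lt_or_ge n 0 with hn | hn
  · obtain ⟨m, rfl⟩ : ∃ m : ℕ, n = -1 - m := ⟨(-n - 1).toNat, by omega⟩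
    rw [inputSeq_negSucc]
    refine (Bw.adjoint.le_opNorm _).trans (mul_le_mul_of_nonneg_left ?_ (norm_nonneg _))
    refine ((Aw.adjoint ^ m).le_opNorm x).trans (mul_le_mul_of_nonneg_right ?_ (norm_nonneg _))
    rw [norm_adjoint_pow]
    exact hM m
  · rw [inputSeq_of_nonneg x hn, norm_zero]
    positivity

/-- The series defining the state is the series solution of the Stein equation, applied to
`(A_w^*)^j x`. -/
theorem stateSeq_inputSeq (hAv : IsStable Av) (hAw : IsStable Aw)
    (hΩ : Ω = Av ∘L Ω ∘L Aw.adjoint + Bv ∘L Bw.adjoint) (x : Xw) (j : ℕ) :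
    stateSeq Av Bv (inputSeq Aw Bw x) (-j) = Ω ((Aw.adjoint ^ j) x) := by
  have h1 := (hasSum_of_stein hAv hAw hΩ).mapL
    (ContinuousLinearMap.apply ℂ Xv ((Aw.adjoint ^ j) x))
  refine (hasSum_of_eq h1 fun m => ?_).tsum_eq
  have h2 : (-j - 1 - m : ℤ) = -1 - ((m + j : ℕ) : ℤ) := by push_cast; ring
  rw [h2, inputSeq_negSucc, pow_add]
  rfl

/-- The response of a system to the input sequence at nonnegative times. -/
theorem conv_inputSeq_natCast (hAv : IsStable Av) (hAw : IsStable Aw)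
    (hΩ : Ω = Av ∘L Ω ∘L Aw.adjoint + Bv ∘L Bw.adjoint) (x : Xw) (n : ℕ) :
    conv (markov Av Bv Cv Dv) (inputSeq Aw Bw x) n = Cv ((Av ^ n) (Ω x)) := by
  have h := stateSeq_inputSeq hAv hAw hΩ x 0
  rw [conv_markov_natCast hAv (isBdd_inputSeq hAw x) (fun n hn => inputSeq_of_nonneg x hn)]
  simp only [Nat.cast_zero, neg_zero, pow_zero, one_apply_eq_self] at h
  rw [h]

/-- The response of a system to the input sequence at negative times. -/
theorem conv_inputSeq_negSucc (hAv : IsStable Av) (hAw : IsStable Aw)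
    (hΩ : Ω = Av ∘L Ω ∘L Aw.adjoint + Bv ∘L Bw.adjoint)
    (hC : C₀ = Dv ∘L Bw.adjoint + Cv ∘L Ω ∘L Aw.adjoint) (x : Xw) (j : ℕ) :
    conv (markov Av Bv Cv Dv) (inputSeq Aw Bw x) (-1 - j) = C₀ ((Aw.adjoint ^ j) x) := by
  have h := stateSeq_inputSeq hAv hAw hΩ x (j + 1)
  have h2 : (-1 - j : ℤ) = -((j + 1 : ℕ) : ℤ) := by push_cast; ring
  rw [conv_markov hAv (isBdd_inputSeq hAw x), inputSeq_negSucc, h2, h, hC, pow_succ']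
  rfl

end SteinSolution

/-! ### The Toeplitz kernel in terms of states -/

section Kernel

variable {E Xv Xw : Type*}
  [NormedAddCommGroup E] [InnerProductSpace ℂ E] [FiniteDimensional ℂ E] [CompleteSpace E]
  [NormedAddCommGroup Xv] [InnerProductSpace ℂ Xv] [FiniteDimensional ℂ Xv] [CompleteSpace Xv]
  [NormedAddCommGroup Xw] [InnerProductSpace ℂ Xw] [FiniteDimensional ℂ Xw] [CompleteSpace Xw]
  {V W R : ℂ → E →L[ℂ] E}
  {Av : Xv →L[ℂ] Xv} {Bv : E →L[ℂ] Xv} {Cv : Xv →L[ℂ] E} {Dv : E →L[ℂ] E}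
  {Aw : Xw →L[ℂ] Xw} {Bw : E →L[ℂ] Xw} {Cw : Xw →L[ℂ] E} {Dw : E →L[ℂ] E}
  {Ω : Xw →L[ℂ] Xv} {C₀ : Xw →L[ℂ] E} {Q : Xw →L[ℂ] Xw}

theorem starFun_of_mem_sphere (W : ℂ → E →L[ℂ] E) {z : ℂ} (hz : z ∈ Metric.sphere (0 : ℂ) 1) :
    starFun W z = (W z).adjoint := by
  have hc : 1 / (starRingEnd ℂ) z = z := by
    have h1 := Complex.mul_conj z
    rw [Complex.normSq_eq_norm_sq, mem_sphere_zero_iff_norm.mp hz] at h1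
    have h2 : (starRingEnd ℂ) z ≠ 0 := by
      simpa using ne_zero_of_mem_sphere_one hz
    rw [div_eq_iff h2, h1]
    simp
  rw [starFun, hc]

theorem hasToeplitzNullity_defect
    (hVrat : IsRationalOn V (Metric.closedBall 0 1)) (hWrat : IsRationalOn W (Metric.closedBall 0 1))
    (hV : IsBiInner V) (hW : IsBiInner W)
    (hR : ∀ z ∈ Metric.sphere (0 : ℂ) 1, R z = V z ∘L starFun W z)
    (hrV : IsStableUnitaryRealization Av Bv Cv Dv V)
    (hrW : IsStableUnitaryRealization Aw Bw Cw Dw W)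
    (hΩ : Ω = Av ∘L Ω ∘L Aw.adjoint + Bv ∘L Bw.adjoint)
    (hC : C₀ = Dv ∘L Bw.adjoint + Cv ∘L Ω ∘L Aw.adjoint)
    (hQ : Q = Aw ∘L Q ∘L Aw.adjoint + C₀.adjoint ∘L C₀) (hQΩ : Q = 1 - Ω.adjoint ∘L Ω) (k : ℕ) :
    HasToeplitzNullity (fun z => z ^ k • R z) (defectNullity Aw Q k) := by
  have sV := hrV.isSymbol hVrat hV
  have sW := hrW.isSymbol hWrat hW
  have sV' := sV.adjoint
  have sW' := sW.adjoint
  have sR := (sV.mul sW').congr fun z hz => (by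
    rw [hR z hz, starFun_of_mem_sphere W hz]; rfl : V z * (W z).adjoint = R z)
  have hbdd : ∀ x, IsBdd (inputSeq Aw Bw x) := isBdd_inputSeq hrW.stable
  -- With `W` in place of `V`, coisometry says that `Ω = 1` solves the first Stein equation and that
  -- `C₀ = 0`. The response of `W` to the canonical input is thus zero at negative times and `C_w
  -- A_w^n x` afterwards.
  have hone : (1 : Xw →L[ℂ] Xw) = Aw ∘L 1 ∘L Aw.adjoint + Bw ∘L Bw.adjoint := by
    ext x
    exact (systemsOperator_coisometry hrW.isUnitary x).1.symm
  have hzero : (0 : Xw →L[ℂ] E) = Dw ∘L Bw.adjoint + Cw ∘L 1 ∘L Aw.adjoint := by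
    ext x
    rw [← add_zero (0 : Xw →L[ℂ] E), add_comm (Dw ∘L Bw.adjoint)]
    simpa using (systemsOperator_coisometry hrW.isUnitary x).2.symm
  have hΦneg : ∀ x, ∀ n < 0, conv (markov Aw Bw Cw Dw) (inputSeq Aw Bw x) n = 0 := by
    intro x n hn
    obtain ⟨m, rfl⟩ : ∃ m : ℕ, n = -1 - m := ⟨(-n - 1).toNat, by omega⟩
    rw [conv_inputSeq_negSucc hrW.stable hrW.stable hone hzero]
    rfl
  have hΦnat : ∀ x (n : ℕ), conv (markov Aw Bw Cw Dw) (inputSeq Aw Bw x) n = Cw ((Aw ^ n) x) :=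
    fun x n => conv_inputSeq_natCast hrW.stable hrW.stable hone x n
  have hRΦ : ∀ x, conv (convMul (markov Av Bv Cv Dv) fun n => (markov Aw Bw Cw Dw (-n)).adjoint)
      (conv (markov Aw Bw Cw Dw) (inputSeq Aw Bw x)) =
      conv (markov Av Bv Cv Dv) (inputSeq Aw Bw x) := by
    intro x
    rw [conv_convMul sV.summable sW'.summable ((hbdd x).conv sW.summable),
      sW'.conv_cancel sW (fun z hz => hrW.adjoint_mul_self hWrat hW hz) (hbdd x)]
  have hsymb : IsSymbol (fun n => convMul (markov Av Bv Cv Dv)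
      (fun n => (markov Aw Bw Cw Dw (-n)).adjoint) (n - k)) fun z => z ^ k • R z := by
    simpa only [zpow_natCast] using sR.shift (k : ℤ)
  let Φ : LinearMap.ker ((1 - Aw ^ k * Q * Aw.adjoint ^ k : Xw →L[ℂ] Xw) : Xw →ₗ[ℂ] Xw) →ₗ[ℂ]
      (ℤ → E) :=
    { toFun := fun x => conv (markov Aw Bw Cw Dw) (inputSeq Aw Bw x)
      map_add' := fun x y => by
        rw [Submodule.coe_add, map_add, conv_add sW.summable (hbdd _) (hbdd _)]
      map_smul' := fun c x => by
        rw [Submodule.coe_smul, map_smul, conv_smul]; rfl }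
  refine hasToeplitzNullity_of_parametrization hsymb Φ ?_ ?_ (fun x => hΦneg x) ?_ ?_
  · intro x hx
    refine Subtype.ext (observable hrW.stable hrW.isUnitary fun n => ?_)
    rw [← hΦnat]
    exact congrFun hx n
  · intro x
    have h : Summable fun n : ℕ => ‖Cw ((Aw ^ n) x)‖ :=
      Summable.of_nonneg_of_le (fun _ => norm_nonneg _) (fun n => (Cw.le_opNorm _).trans
        (mul_le_mul_of_nonneg_left ((Aw ^ n).le_opNorm _) (norm_nonneg _)))
        ((hrW.stable.summable_norm_pow.mul_right ‖(x : Xw)‖).mul_left ‖Cw‖)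
    refine (Nat.cast_injective (R := ℤ)).summable_iff (fun n hn => ?_) |>.mp ?_
    · change ‖conv (markov Aw Bw Cw Dw) (inputSeq Aw Bw x) n‖ = 0
      rw [hΦneg x n (by
        by_contra hc
        exact hn ⟨n.toNat, by omega⟩), norm_zero]
    · refine h.congr fun n => ?_
      rw [← hΦnat]
      rfl
  · intro x n hn
    have hx := (mem_ker_defect_iff hQ hQΩ k (x : Xw)).mp x.2
    rw [conv_shift]
    change conv _ (conv _ _) _ = 0
    rw [hRΦ]
    rcases lt_or_ge (n - k) 0 with h | h
    · obtain ⟨m, hm⟩ : ∃ m : ℕ, n - k = -1 - m := ⟨(-(n - k) - 1).toNat, by omega⟩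
      rw [hm, conv_inputSeq_negSucc hrV.stable hrW.stable hΩ hC]
      exact hx.2 m (by omega)
    · obtain ⟨m, hm⟩ : ∃ m : ℕ, n - k = m := ⟨(n - k).toNat, by omega⟩
      rw [hm, conv_inputSeq_natCast hrV.stable hrW.stable hΩ, hx.1, map_zero, map_zero]
  · intro f hf hfneg hfker
    have hker : ∀ n : ℤ, -k ≤ n → conv (markov Av Bv Cv Dv)
        (conv (fun n => (markov Aw Bw Cw Dw (-n)).adjoint) f) n = 0 := by
      intro n hn
      have := hfker (n + k) (by omega)
      rwa [conv_shift, add_sub_cancel_right, conv_convMul sV.summable sW'.summable hf] at this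
    have hmneg : ∀ n : ℤ, 0 < n → (markov Av Bv Cv Dv (-n)).adjoint = 0 := fun n hn => by
      rw [markov_of_neg (by omega), map_zero]
    set h := conv (fun n => (markov Aw Bw Cw Dw (-n)).adjoint) f with hh
    have hhb : IsBdd h := hf.conv sW'.summable
    -- `h = V^* (V h)` with `V^*` anticausal, and `V h` vanishes from time `-k ≤ 0` on.
    have hhneg : ∀ n, 0 ≤ n → h n = 0 := by
      intro n hn
      rw [← sV'.conv_cancel sV (fun z hz => hrV.adjoint_mul_self hVrat hV hz) hhb]
      exact conv_apply_eq_zero_of_nonpos hmneg (fun m hm => hker m (by omega)) hn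
    have hfh : conv (markov Aw Bw Cw Dw) h = f :=
      sW.conv_cancel sW' (fun z hz => hrW.mul_adjoint_self hWrat hW hz) hf
    -- The state of `W` at time 0 is the parameter: past inputs affect `f` at nonnegative times only
    -- through it.
    set x := stateSeq Aw Bw h 0
    have hfx : conv (markov Aw Bw Cw Dw) (inputSeq Aw Bw x) = f := by
      funext n
      rcases lt_or_ge n 0 with hn | hn
      · rw [hΦneg x n hn, hfneg n hn]
      · lift n to ℕ using hn
        rw [hΦnat, ← hfh, conv_markov_natCast hrW.stable hhb hhneg]
    have hker' : ∀ n : ℤ, -k ≤ n → conv (markov Av Bv Cv Dv) (inputSeq Aw Bw x) n = 0 := by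
      intro n hn
      rw [← hRΦ, hfx, conv_convMul sV.summable sW'.summable hf]
      exact hker n hn
    refine ⟨⟨x, ?_⟩, hfx⟩
    refine LinearMap.mem_ker.mpr ((mem_ker_defect_iff hQ hQΩ k x).mpr ⟨?_, fun j hj => ?_⟩)
    · refine observable hrV.stable hrV.isUnitary fun n => ?_
      rw [← conv_inputSeq_natCast hrV.stable hrW.stable hΩ]
      exact hker' n (by omega)
    · rw [← conv_inputSeq_negSucc hrV.stable hrW.stable hΩ hC]
      exact hker' _ (by omega)

end Kernel

/-! ### The Toeplitz kernel from a Wiener–Hopf factorization -/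

section WienerHopfKernel

variable {E : Type*} [NormedAddCommGroup E] [InnerProductSpace ℂ E] [FiniteDimensional ℂ E]
  [CompleteSpace E]

/-- By compactness, `G` is analytic on a disc of radius greater than 1, so its Taylor series
converges absolutely at radius 1. -/
theorem exists_isSymbol_of_analyticOnNhd {G : ℂ → E →L[ℂ] E}
    (hG : AnalyticOnNhd ℂ G (Metric.closedBall 0 1)) :
    ∃ a, IsSymbol a G ∧ ∀ n < 0, a n = 0 := by
  obtain ⟨δ, hδ, hsub⟩ := (isCompact_closedBall (0 : ℂ) 1).exists_cthickening_subset_open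
    (isOpen_analyticAt ℂ G) hG
  rw [cthickening_closedBall hδ.le zero_le_one] at hsub
  obtain ⟨r, hr⟩ : ∃ r : NNReal, (r : ℝ) = δ + 1 :=
    ⟨(δ + 1).toNNReal, Real.coe_toNNReal _ (by positivity)⟩
  rw [← hr] at hsub
  have hd : DifferentiableOn ℂ G (Metric.closedBall 0 r) :=
    fun z hz => (hsub hz).differentiableAt.differentiableWithinAt
  have hr1 : 1 < r := by rw [← NNReal.coe_lt_coe, hr, NNReal.coe_one]; linarith
  have hlt : ((1 : NNReal) : ENNReal) < r := ENNReal.coe_lt_coe.mpr hr1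
  obtain ⟨p, hp⟩ : ∃ p, HasFPowerSeriesOnBall G p 0 r :=
    ⟨_, hd.hasFPowerSeriesOnBall (zero_lt_one.trans hr1)⟩
  have hs : Summable fun n : ℕ => ‖p.coeff n‖ := by
    refine (p.summable_norm_mul_pow (hlt.trans_le hp.r_le)).congr fun n => ?_
    simp [FormalMultilinearSeries.norm_apply_eq_norm_coef]
  have hcast : ∀ n : ℤ, n ∉ Set.range (Nat.cast : ℕ → ℤ) → n < 0 := fun n hn => by
    by_contra hc
    exact hn ⟨n.toNat, by omega⟩
  refine ⟨fun n => if n < 0 then 0 else p.coeff n.toNat, ⟨?_, fun z hz => ?_⟩,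
    fun n hn => if_pos hn⟩
  · refine (Nat.cast_injective (R := ℤ)).summable_iff (fun n hn => ?_) |>.mp ?_
    · rw [if_pos (hcast n hn), norm_zero]
    · refine hs.congr fun n => ?_
      simp [not_lt.mpr (Int.natCast_nonneg n)]
  · refine (Nat.cast_injective (R := ℤ)).hasSum_iff (fun n hn => ?_) |>.mp ?_
    · rw [if_pos (hcast n hn), smul_zero]
    · have h1 := hp.hasSum (y := z) (by
        rw [Metric.mem_eball, edist_zero_right, ← ofReal_norm, mem_sphere_zero_iff_norm.mp hz]
        simpa using hlt)
      rw [zero_add] at h1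
      refine hasSum_of_eq h1 fun n => ?_
      simp [not_lt.mpr (Int.natCast_nonneg n)]

/-- The coordinate projection `diag(0, …, 1, …, 0)` onto the `j`-th basis vector. -/
def coordProj {m : ℕ} (b : Module.Basis (Fin m) ℂ E) (j : Fin m) : E →L[ℂ] E :=
  LinearMap.toContinuousLinearMap (Matrix.toLin b b (Matrix.diagonal (Pi.single j 1)))

theorem repr_diagonal {m : ℕ} (b : Module.Basis (Fin m) ℂ E) (d : Fin m → ℂ) (v : E) (i : Fin m) :
    b.repr (Matrix.toLin b b (Matrix.diagonal d) v) i = d i * b.repr v i := by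
  rw [Matrix.repr_toLin, Matrix.mulVec_diagonal]

theorem repr_coordProj {m : ℕ} (b : Module.Basis (Fin m) ℂ E) (j : Fin m) (v : E) (i : Fin m) :
    b.repr (coordProj b j v) i = if i = j then b.repr v i else 0 := by
  change b.repr (Matrix.toLin b b (Matrix.diagonal (Pi.single j 1)) v) i = _
  rw [repr_diagonal, Pi.single_apply]
  split_ifs <;> simp

/-- The Laurent coefficients of `diag(z ^ ν_j)`. -/
def diagSeq {m : ℕ} (b : Module.Basis (Fin m) ℂ E) (ν : Fin m → ℤ) (n : ℤ) : E →L[ℂ] E :=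
  ∑ j, (Pi.single (ν j) (coordProj b j) : ℤ → E →L[ℂ] E) n

theorem isSymbol_diagSeq {m : ℕ} (b : Module.Basis (Fin m) ℂ E) (ν : Fin m → ℤ) :
    IsSymbol (diagSeq b ν) (diagPow b ν) := by
  refine (IsSymbol.sum Finset.univ fun j _ => isSymbol_single (ν j) (coordProj b j)).congr
    fun z _ => ?_
  ext v
  refine b.ext_elem fun i => ?_
  change _ = b.repr (Matrix.toLin b b (Matrix.diagonal fun j => z ^ ν j) v) i
  rw [repr_diagonal]
  simp [repr_coordProj]

theorem conv_diagSeq {m : ℕ} (b : Module.Basis (Fin m) ℂ E) (ν : Fin m → ℤ) (g : ℤ → E) (n : ℤ) :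
    conv (diagSeq b ν) g n = ∑ j, coordProj b j (g (n - ν j)) := by
  have h : HasSum (fun i => ∑ j, (Pi.single (ν j) (coordProj b j) : ℤ → E →L[ℂ] E) i (g (n - i)))
      (∑ j, coordProj b j (g (n - ν j))) := by
    refine hasSum_sum fun j _ => ?_
    have := hasSum_single (f := fun i : ℤ =>
      (Pi.single (ν j) (coordProj b j) : ℤ → E →L[ℂ] E) i (g (n - i))) (ν j)
      fun i hi => by rw [Pi.single_eq_of_ne hi]; rfl
    simpa using this
  refine (hasSum_of_eq h fun i => ?_).tsum_eq
  simp [diagSeq]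

/-- The diagonal factor acts by delaying the `i`-th coordinate by `ν i`. -/
theorem repr_conv_diagSeq {m : ℕ} (b : Module.Basis (Fin m) ℂ E) (ν : Fin m → ℤ) (g : ℤ → E)
    (n : ℤ) (i : Fin m) : b.repr (conv (diagSeq b ν) g n) i = b.repr (g (n - ν i)) i := by
  rw [conv_diagSeq]
  simp [repr_coordProj]

/-- The coefficients of a vector polynomial whose `j`-th coordinate has degree less than `d j`. -/
def polySeq {m : ℕ} (b : Module.Basis (Fin m) ℂ E) (d : Fin m → ℕ) :
    ((Σ j, Fin (d j)) → ℂ) →ₗ[ℂ] (ℤ → E) :=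
  LinearMap.pi fun n => b.equivFun.symm.toLinearMap ∘ₗ LinearMap.pi fun j =>
    if h : 0 ≤ n ∧ n.toNat < d j then LinearMap.proj ⟨j, ⟨n.toNat, h.2⟩⟩ else 0

theorem repr_polySeq {m : ℕ} (b : Module.Basis (Fin m) ℂ E) (d : Fin m → ℕ)
    (y : (Σ j, Fin (d j)) → ℂ) (n : ℤ) (j : Fin m) : b.repr (polySeq b d y n) j =
      if h : 0 ≤ n ∧ n.toNat < d j then y ⟨j, ⟨n.toNat, h.2⟩⟩ else 0 := by
  have h1 : b.equivFun (polySeq b d y n) j = (LinearMap.pi fun j =>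
    if h : 0 ≤ n ∧ n.toNat < d j then
      (LinearMap.proj ⟨j, ⟨n.toNat, h.2⟩⟩ : ((Σ j, Fin (d j)) → ℂ) →ₗ[ℂ] ℂ) else 0) y j := by
    rw [polySeq, LinearMap.pi_apply, LinearMap.comp_apply, LinearEquiv.coe_coe,
      LinearEquiv.apply_symm_apply]
  rw [Module.Basis.equivFun_apply, LinearMap.pi_apply] at h1
  rw [h1]
  split_ifs <;> rfl

theorem polySeq_of_neg {m : ℕ} (b : Module.Basis (Fin m) ℂ E) (d : Fin m → ℕ)
    (y : (Σ j, Fin (d j)) → ℂ) {n : ℤ} (hn : n < 0) : polySeq b d y n = 0 :=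
  b.ext_elem fun j => by
    rw [repr_polySeq, dif_neg (by omega), map_zero]; rfl

theorem summable_norm_polySeq {m : ℕ} (b : Module.Basis (Fin m) ℂ E) (d : Fin m → ℕ)
    (y : (Σ j, Fin (d j)) → ℂ) : Summable fun n => ‖polySeq b d y n‖ := by
  refine summable_of_ne_finset_zero (s := Finset.Ico 0 ((∑ j, d j : ℕ) : ℤ)) fun n hn => ?_
  rw [norm_eq_zero]
  refine b.ext_elem fun j => ?_
  have hj : d j ≤ ∑ j, d j := Finset.single_le_sum (fun _ _ => Nat.zero_le _) (Finset.mem_univ j)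
  rw [Finset.mem_Ico] at hn
  rw [repr_polySeq, dif_neg (by omega), map_zero]
  rfl

theorem polySeq_eq_zero {m : ℕ} (b : Module.Basis (Fin m) ℂ E) (d : Fin m → ℕ)
    {y : (Σ j, Fin (d j)) → ℂ} (hy : polySeq b d y = 0) : y = 0 := by
  funext ⟨j, i⟩
  have h := repr_polySeq b d y i j
  rw [hy, dif_pos ⟨by omega, by simp⟩] at h
  simpa using h.symm

/-- The nullities of the Toeplitz operators of `z ^ k F` in terms of the Wiener-Hopf indices. -/
theorem IsWienerHopfIndices.hasToeplitzNullity {F : ℂ → E →L[ℂ] E}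
    {ν : Fin (Module.finrank ℂ E) → ℤ} (h : IsWienerHopfIndices F ν) (k : ℕ) :
    HasToeplitzNullity (fun z => z ^ k • F z) (∑ j, (-ν j - k).toNat) := by
  obtain ⟨b, M, Wp, hM, hWp, hF⟩ := h
  obtain ⟨m, sm, hm⟩ := exists_isSymbol_of_analyticOnNhd hM.analytic
  obtain ⟨m', sm', hm'⟩ := exists_isSymbol_of_analyticOnNhd hM.analytic_inverse
  obtain ⟨w, sw, hw⟩ := exists_isSymbol_of_analyticOnNhd hWp.analytic
  obtain ⟨w', sw', hw'⟩ := exists_isSymbol_of_analyticOnNhd hWp.analytic_inverse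
  replace hm : ∀ n : ℤ, 0 < n → m (-n) = 0 := fun n hn => hm _ (by omega)
  replace hm' : ∀ n : ℤ, 0 < n → m' (-n) = 0 := fun n hn => hm' _ (by omega)
  have smr := sm.reflect
  have smr' := sm'.reflect
  have sd := isSymbol_diagSeq b ν
  have sF := ((smr.mul sd).mul sw).congr fun z hz => (by
    rw [hF z hz]; rfl : M z⁻¹ * diagPow b ν z * Wp z = F z)
  have hconv : ∀ f, IsBdd f → conv (convMul (convMul (fun n => m (-n)) (diagSeq b ν)) w) f =
      conv (fun n => m (-n)) (conv (diagSeq b ν) (conv w f)) := by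
    intro f hf
    rw [conv_convMul (smr.mul sd).summable sw.summable hf,
      conv_convMul smr.summable sd.summable (hf.conv sw.summable)]
  have hww' : ∀ z ∈ Metric.sphere (0 : ℂ) 1, Wp z * Ring.inverse (Wp z) = 1 := fun z hz =>
    Ring.mul_inverse_cancel _ (hWp.isUnit z (Metric.sphere_subset_closedBall hz))
  have hw'w : ∀ z ∈ Metric.sphere (0 : ℂ) 1, Ring.inverse (Wp z) * Wp z = 1 := fun z hz =>
    Ring.inverse_mul_cancel _ (hWp.isUnit z (Metric.sphere_subset_closedBall hz))
  have hm'm : ∀ z ∈ Metric.sphere (0 : ℂ) 1, Ring.inverse (M z⁻¹) * M z⁻¹ = 1 := fun z hz =>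
    Ring.inverse_mul_cancel _ (hM.isUnit _ (Metric.sphere_subset_closedBall (inv_mem_sphere hz)))
  have hsymb : IsSymbol (fun n => convMul (convMul (fun n => m (-n)) (diagSeq b ν)) w (n - k))
      fun z => z ^ k • F z := by
    simpa only [zpow_natCast] using sF.shift (k : ℤ)
  -- With `g = W₊ f` causal, the delayed coordinate `j` must vanish from time `-k` on, so `g` has
  -- coordinate `j` supported on `0 ≤ n < -ν_j - k`. The truncation gives 0 when this range is
  -- empty.
  let d : Fin (Module.finrank ℂ E) → ℕ := fun j => (-ν j - k).toNat
  have hpb : ∀ y, IsBdd (polySeq b d y) := fun y => isBdd_of_summable (summable_norm_polySeq b d y)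
  let Φ : ((Σ j, Fin (d j)) → ℂ) →ₗ[ℂ] (ℤ → E) :=
    { toFun := fun y => conv w' (polySeq b d y)
      map_add' := fun x y => by rw [map_add, conv_add sw'.summable (hpb _) (hpb _)]
      map_smul' := fun c y => by rw [map_smul, conv_smul]; rfl }
  have hrank : Module.finrank ℂ ((Σ j, Fin (d j)) → ℂ) = ∑ j, (-ν j - k).toNat := by
    rw [Module.finrank_fintype_fun_eq_card, Fintype.card_sigma]
    simp [d]
  have hwΦ : ∀ y, conv w (Φ y) = polySeq b d y := fun y => sw.conv_cancel sw' hww' (hpb y)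
  have hΦb : ∀ y, IsBdd (Φ y) := fun y => (hpb y).conv sw'.summable
  rw [← hrank]
  refine hasToeplitzNullity_of_parametrization hsymb Φ (fun y hy => ?_)
    (fun y => summable_norm_conv sw'.summable (summable_norm_polySeq b d y))
    (fun y n hn => conv_apply_eq_zero_of_nonneg hw' (fun i hi => polySeq_of_neg b d y hi) hn)
    (fun y n hn => ?_) (fun f hf hfneg hfker => ?_)
  · refine polySeq_eq_zero b d ?_
    rw [← hwΦ, hy]
    funext n
    simp [conv]
  · rw [conv_shift, hconv _ (hΦb y), hwΦ]
    refine conv_apply_eq_zero_of_nonpos (c := -k) hm (fun i hi => b.ext_elem fun j => ?_)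
      (by omega)
    rw [repr_conv_diagSeq, repr_polySeq, dif_neg (by simp only [d]; omega), map_zero]
    rfl
  · have hgb : IsBdd (conv w f) := hf.conv sw.summable
    -- The factor `W₋⁻¹` is anticausal, so it can be cancelled without disturbing the vanishing from
    -- time `-k` on.
    have hker : ∀ n : ℤ, -k ≤ n → conv (diagSeq b ν) (conv w f) n = 0 := by
      intro n hn
      rw [← smr'.conv_cancel smr hm'm (hgb.conv sd.summable)]
      refine conv_apply_eq_zero_of_nonpos (c := -k) hm' (fun i hi => ?_) hn
      have := hfker (i + k) (by omega)
      rwa [conv_shift, add_sub_cancel_right, hconv f hf] at this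
    refine ⟨fun s => b.repr (conv w f s.2) s.1, ?_⟩
    have hpoly : polySeq b d (fun s => b.repr (conv w f s.2) s.1) = conv w f := by
      funext n
      refine b.ext_elem fun j => ?_
      rw [repr_polySeq]
      split_ifs with hn
      · simp only
        rw [Int.toNat_of_nonneg hn.1]
      · rcases lt_or_ge n 0 with h0 | h0
        · rw [conv_apply_eq_zero_of_nonneg hw hfneg h0, map_zero]; rfl
        · have h1 := repr_conv_diagSeq b ν (conv w f) (n + ν j) j
          rw [hker _ (by simp only [d] at hn; omega), add_sub_cancel_right, map_zero] at h1
          exact h1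
    change conv w' _ = f
    rw [hpoly]
    exact sw'.conv_cancel sw hw'w hf

end WienerHopfKernel

/-! ### Conjugate partitions -/

section ConjugatePartition

/-- Each truncated summand drops by 1 if `ν_j ≤ -k`, and otherwise both of its values are 0. -/
theorem toNat_sub_toNat_eq_card {N : ℕ} (ν : Fin N → ℤ) {k : ℕ} (hk : 1 ≤ k) :
    ((∑ j, (-ν j - (k - 1 : ℕ)).toNat : ℕ) : ℤ) - ((∑ j, (-ν j - k).toNat : ℕ) : ℤ) =
      (Finset.univ.val.map ν).countP (· ≤ -(k : ℤ)) := by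
  rw [Multiset.countP_map]
  have : (Multiset.filter (fun j => ν j ≤ -(k : ℤ)) (Finset.univ : Finset (Fin N)).val).card =
      (Finset.univ.filter fun j => ν j ≤ -(k : ℤ)).card := rfl
  rw [this, Finset.card_filter]
  push_cast
  rw [← Finset.sum_sub_distrib]
  refine Finset.sum_congr rfl fun j _ => ?_
  split_ifs <;> omega

/-- As `k ≥ 1`, an index at most `-k` is negative, so the filter discards nothing that is counted.
-/
theorem countP_neg_indices {N p : ℕ} {ν : Fin N → ℤ} {κ : Fin p → ℤ}
    (h : (Finset.univ.val.map fun j => -κ j) = (Finset.univ.val.map ν).filter (· < 0)) {k : ℕ}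
    (hk : 1 ≤ k) : (Finset.univ.val.map ν).countP (· ≤ -(k : ℤ)) =
      (Finset.univ.filter fun j => (k : ℤ) ≤ κ j).card := by
  have h1 := congrArg (Multiset.countP (· ≤ -(k : ℤ))) h
  rw [Multiset.countP_filter, Multiset.countP_map] at h1
  rw [Finset.card_def, Finset.filter_val]
  simp only [neg_le_neg_iff] at h1
  rw [h1]
  refine Multiset.countP_congr rfl fun x _ => ?_
  simp only [eq_iff_iff]
  omega

theorem one_le_of_neg_indices {N p : ℕ} {ν : Fin N → ℤ} {κ : Fin p → ℤ}
    (h : (Finset.univ.val.map fun j => -κ j) = (Finset.univ.val.map ν).filter (· < 0))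
    (j : Fin p) : 1 ≤ κ j := by
  have h1 : -κ j ∈ (Finset.univ.val.map ν).filter (· < 0) := by
    rw [← h]
    exact Multiset.mem_map_of_mem _ (Finset.mem_univ j)
  have := (Multiset.mem_filter.mp h1).2
  omega

/-- For an antitone `κ` the filtered set is an initial segment, so its size decides whether it
contains `j`. The `+ 1` is due to indexing from zero. -/
theorem lt_card_filter_iff {p : ℕ} {κ : Fin p → ℤ} (hκ : Antitone κ) (j : Fin p) (c : ℤ) :
    (j : ℕ) + 1 ≤ (Finset.univ.filter fun i => c ≤ κ i).card ↔ c ≤ κ j := by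
  constructor
  · intro h
    by_contra hc
    have hsub : (Finset.univ.filter fun i => c ≤ κ i) ⊆ Finset.Iio j := by
      intro i hi
      rw [Finset.mem_Iio]
      by_contra hij
      exact hc ((Finset.mem_filter.mp hi).2.trans (hκ (not_lt.mp hij)))
    have := Finset.card_le_card hsub
    rw [Fin.card_Iio] at this
    omega
  · intro h
    have hsub : Finset.Iic j ⊆ Finset.univ.filter fun i => c ≤ κ i := fun i hi =>
      Finset.mem_filter.mpr ⟨Finset.mem_univ i, h.trans (hκ (Finset.mem_Iic.mp hi))⟩
    have := Finset.card_le_card hsub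
    rwa [Fin.card_Iic] at this

end ConjugatePartition

end WienerHopf

end

/-! ### The main theorem -/

theorem theorem2p2
    {E Xv Xw : Type*}
    [NormedAddCommGroup E] [InnerProductSpace ℂ E] [FiniteDimensional ℂ E] [CompleteSpace E]
    [NormedAddCommGroup Xv] [InnerProductSpace ℂ Xv] [FiniteDimensional ℂ Xv] [CompleteSpace Xv]
    [NormedAddCommGroup Xw] [InnerProductSpace ℂ Xw] [FiniteDimensional ℂ Xw] [CompleteSpace Xw]
    (V W R : ℂ → E →L[ℂ] E)
    (hVrat : WienerHopf.IsRationalOn V (Metric.closedBall 0 1))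
    (hWrat : WienerHopf.IsRationalOn W (Metric.closedBall 0 1))
    (hV : WienerHopf.IsBiInner V) (hW : WienerHopf.IsBiInner W)
    (hR : ∀ z ∈ Metric.sphere (0 : ℂ) 1, R z = V z ∘L WienerHopf.starFun W z)
    (Av : Xv →L[ℂ] Xv) (Bv : E →L[ℂ] Xv) (Cv : Xv →L[ℂ] E) (Dv : E →L[ℂ] E)
    (Aw : Xw →L[ℂ] Xw) (Bw : E →L[ℂ] Xw) (Cw : Xw →L[ℂ] E) (Dw : E →L[ℂ] E)
    (hrV : WienerHopf.IsStableUnitaryRealization Av Bv Cv Dv V)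
    (hrW : WienerHopf.IsStableUnitaryRealization Aw Bw Cw Dw W) :
    -- the first Stein equation has a unique solution
    (∃! Ω : Xw →L[ℂ] Xv, Ω = Av ∘L Ω ∘L Aw.adjoint + Bv ∘L Bw.adjoint) ∧
    ∀ Ω : Xw →L[ℂ] Xv, Ω = Av ∘L Ω ∘L Aw.adjoint + Bv ∘L Bw.adjoint →
    ∀ C₀ : Xw →L[ℂ] E, C₀ = Dv ∘L Bw.adjoint + Cv ∘L Ω ∘L Aw.adjoint →
      -- the second Stein equation has a unique solution
      (∃! Q : Xw →L[ℂ] Xw, Q = Aw ∘L Q ∘L Aw.adjoint + C₀.adjoint ∘L C₀) ∧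
      ∀ Q : Xw →L[ℂ] Xw, Q = Aw ∘L Q ∘L Aw.adjoint + C₀.adjoint ∘L C₀ →
        -- (1) `Q` is a positive contraction
        (Q.IsPositive ∧ ‖Q‖ ≤ 1) ∧
        -- (2) the nullities of the Toeplitz operators
        (WienerHopf.HasToeplitzNullity R
            ((Q : Xw →ₗ[ℂ] Xw).charpoly.rootMultiplicity 1) ∧
          WienerHopf.HasToeplitzNullity R
            (Module.finrank ℂ (LinearMap.ker ((1 - Q : Xw →L[ℂ] Xw) : Xw →ₗ[ℂ] Xw))) ∧
          ∀ k : ℕ, WienerHopf.HasToeplitzNullity (fun z => z ^ k • R z)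
            (WienerHopf.defectNullity Aw Q k)) ∧
        -- (3) the negative Wiener-Hopf indices
        (∀ (p : ℕ) (κ : Fin p → ℤ), WienerHopf.IsNegativeWienerHopfIndices R p κ →
          (p : ℤ) = WienerHopf.mu Aw Q 1 ∧
          ∀ j : Fin p, ∃ n : ℕ, κ j = (n : ℤ) ∧
            {k : ℕ | 1 ≤ k ∧ (j : ℤ) + 1 ≤ WienerHopf.mu Aw Q k}.encard = (n : ℕ∞)) := by
  have hsv := hrV.stable
  have hsw := hrW.stable
  refine ⟨WienerHopf.existsUnique_stein hsv hsw _, fun Ω hΩ C₀ hC => ?_⟩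
  refine ⟨WienerHopf.existsUnique_stein hsw hsw _, fun Q hQ => ?_⟩
  have hQΩ : Q = 1 - Ω.adjoint ∘L Ω := WienerHopf.stein_unique hsw hsw hQ
    (WienerHopf.stein_one_sub_adjoint_comp hrV.isUnitary hrW.isUnitary hΩ hC)
  have hpos := WienerHopf.isPositive_of_stein hsw hQ
  have hnull := WienerHopf.hasToeplitzNullity_defect hVrat hWrat hV hW hR hrV hrW hΩ hC hQ hQΩ
  have hnull0 : WienerHopf.HasToeplitzNullity R
      (Module.finrank ℂ (LinearMap.ker ((1 - Q : Xw →L[ℂ] Xw) : Xw →ₗ[ℂ] Xw))) := by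
    have hd : WienerHopf.defectNullity Aw Q 0 = Module.finrank ℂ
        (LinearMap.ker ((1 - Q : Xw →L[ℂ] Xw) : Xw →ₗ[ℂ] Xw)) := by
      rw [WienerHopf.defectNullity, pow_zero, pow_zero, one_mul, mul_one]
    have h := hnull 0
    simp only [pow_zero, one_smul] at h
    rwa [hd] at h
  refine ⟨⟨hpos, WienerHopf.norm_le_one_of_eq_one_sub hpos hQΩ⟩, ⟨?_, hnull0, hnull⟩, ?_⟩
  · rwa [WienerHopf.rootMultiplicity_charpoly_eq_finrank_ker hpos]
  · rintro p κ ⟨hκ, ν, hν, hκν⟩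
    -- Both formulas give the nullity of the same Toeplitz operator, which its symbol determines.
    have hdef : ∀ k, WienerHopf.defectNullity Aw Q k = ∑ j, (-ν j - k).toNat := fun k =>
      (hnull k).unique (hν.hasToeplitzNullity k)
    have hmu : ∀ k : ℕ, 1 ≤ k → WienerHopf.mu Aw Q k =
        ((Finset.univ.filter fun j => (k : ℤ) ≤ κ j).card : ℤ) := by
      intro k hk
      rw [← WienerHopf.countP_neg_indices hκν hk, ← WienerHopf.toNat_sub_toNat_eq_card ν hk,
        WienerHopf.mu, hdef, hdef]
    have hone := WienerHopf.one_le_of_neg_indices hκν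
    refine ⟨?_, fun j => ⟨(κ j).toNat, by have := hone j; omega, ?_⟩⟩
    · rw [hmu 1 le_rfl, Finset.filter_true_of_mem fun j _ => by simpa using hone j]
      simp
    -- The condition on `k` amounts to `1 ≤ k ≤ κ j`, an interval with `κ j` elements; `toNat` is
    -- harmless since `κ j ≥ 1`.
    · have hset : {k : ℕ | 1 ≤ k ∧ (j : ℤ) + 1 ≤ WienerHopf.mu Aw Q k} =
          (Finset.Icc 1 (κ j).toNat : Set ℕ) := by
        ext k
        rw [Set.mem_ofPred_eq, Finset.coe_Icc, Set.mem_Icc]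
        refine and_congr_right fun hk => ?_
        rw [hmu k hk]
        have := WienerHopf.lt_card_filter_iff hκ j k
        omega
      rw [hset, Set.encard_coe_eq_coe_finsetCard]
      simp
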